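/- **Setting.** For a real skew-symmetric form $\theta$ on $\mathbb Z^d$, let $A_\theta$ be the smooth noncommutative torus: all $\sum_{n\in\mathbb Z^d}c_nU_n$ with rapidly decreasing $c_n\in\mathbb C$, where $U_mU_n=e^{\frac i2\theta(m,n)}U_{m+n}$ and $U_n^*=U_{-n}$. Its trace is $\tau(\sum c_nU_n)=c_0$, and it carries its $C^*$-norm. Let $L_\theta=\mathbb R^d$ be the commutative Lie algebra of the derivations $\delta_vU_n=\langle v,n\rangle U_n$. All modules below are modules over these smooth algebras (smooth parts). A Hermitian module carries a positive definite inner product with values in the algebra; it is projective if it is isometric to $pA_\theta^n$ for some $n$ and some selfadjoint projection $p$ (for left modules, to $A_\theta^np$). A Hermitian connection on a right module $E$ is a real-linear family of operators $\nabla_v$ $(v\in L_\theta)$ on $E$ with $\nabla_v(xa)=(\nabla_vx)a+x\,\delta_v(a)$ and $\delta_v\langle x,y\rangle=\langle x,\nabla_vy\rangle-\langle\nabla_vx,y\rangle$ (similarly for left modules). Its curvature is $F(v,w)=[\nabla_v,\nabla_w]$. Let $\theta,\hat\theta$ be skew forms on $\mathbb Z^4$ and let $\mathcal P$ be a projective Hermitian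 left $A_{\theta\oplus(-\hat\theta)}$-module; thus $\mathcal P$ is a left $A_\theta$- and right $A_{\hat\theta}$-module. Let $\nabla\oplus\hat\nabla$ be a Hermitian connection on $\mathcal P$ with constant curvature: $$[\nabla_\alpha,\nabla_\beta]=\omega_{\alpha\beta},\qquad [\nabla_\alpha,\hat\nabla_\mu]=\sigma_{\alpha\mu},\qquad [\hat\nabla_\mu,\hat\nabla_\nu]=\hat\omega_{\mu\nu}$$ are scalars for $\alpha,\beta\in L_\theta$ and $\mu,\nu\in L_{\hat\theta}$; assume that $\sigma$ is non-degenerate. Fix an inner product and an orientation on $L_\theta$, with an oriented orthonormal basis $\alpha_1,\dots,\alpha_4$. Since $\sigma$ is purely imaginary, $\sigma/i$ identifies $L_{\hat\theta}$ with $L_\theta'\cong L_\theta$; give $L_{\hat\theta}$ the inner product and orientation transported in this way. For a two-form $F$ on $L_\theta$ or $L_{\hat\theta}$ put $F^+=\frac12(F+\star F)$. Let $R$ be a projective Hermitian right $A_\theta$-module with a Hermitian connection $\nabla^R$ of curvature $F$. On $R\otimes_{A_\theta}\mathcal P$ consider the right action of $A_{\hat\theta}$, the operators $\nabla^R_\alpha+\nabla_\alpha:=\nabla^R_\alpha\otimes1+1\otimes\nabla_\alpha$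 and $1\otimes\hat\nabla_\mu$, and the $A_{\hat\theta}$-valued inner product $$\langle r\otimes p,r'\otimes p'\rangle=(\tau\otimes\mathrm{id})\{\langle r,r'\rangle p',p\},$$ where $\{\cdot,\cdot\}$ is the inner product of $\mathcal P$ (linear in the first variable). Let $S^\pm=\mathbb C^2$ be the half-spin spaces of $L_\theta$ with Gamma matrices $\Gamma^i:S^\pm\to S^\mp$, where $\Gamma^i\Gamma^j-\Gamma^j\Gamma^i$ is antiselfdual on $S^-$, and let $$D^\pm=\sum_i\Gamma^i(\nabla^R_{\alpha_i}+\nabla_{\alpha_i}):\ (R\otimes_{A_\theta}\mathcal P)\otimes S^\pm\to(R\otimes_{A_\theta}\mathcal P)\otimes S^\mp .$$ Call $\nabla^R$ *$\mathcal P$-irreducible* if $\Delta=\sum_i(\nabla^R_{\alpha_i}+\nabla_{\alpha_i})^2$ on $R\otimes_{A_\theta}\mathcal P$ has an inverse operator $G$ that is bounded for the norm $\|x\|=\|\langle x,x\rangle\|^{1/2}$. **Theorem.** Suppose that $\nabla^R$ is $\mathcal P$-irreducible and $F^++\omega^+\cdot1=0$. Let $\hat R=\ker D^-$. Then there is a unique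 orthogonal projection $P$ (with respect to the $A_{\hat\theta}$-valued inner product) of $(R\otimes_{A_\theta}\mathcal P)\otimes S^-$ onto $\hat R$. With the inherited inner product $\hat R$ is a Hermitian $A_{\hat\theta}$-module, and $\nabla^{\hat R}_\mu=P\circ(1\otimes\hat\nabla_\mu)|_{\hat R}$ is a Hermitian $A_{\hat\theta}$-connection on it. The curvature $\hat F$ of the noncommutative Nahm transform $(\hat R,\nabla^{\hat R})$ satisfies $$\hat F^+-\hat\omega^+\cdot1=0 .$$ In particular $\nabla^{\hat R}$ is again an instanton, that is, a connection the self-dual part of whose curvature is a scalar. -/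

import Mathlib

set_option linter.unusedSectionVars false

namespace NCNahm

noncomputable section

/-- A real skew-symmetric bilinear form, given by its matrix. -/
structure SkewForm (ι : Type) where
  mat : Matrix ι ι ℝ
  skew : mat.transpose = -mat

section torus

variable {ι : Type} [Fintype ι]

/-- The value `θ(m, n)` of the form on integer vectors. -/
def SkewForm.form (θ : SkewForm ι) (m n : ι → ℤ) : ℝ := ∑ i, ∑ j, (m i : ℝ) * θ.mat i j * (n j : ℝ)

theorem SkewForm.form_swap (θ : SkewForm ι) (m n : ι → ℤ) : θ.form n m = -θ.form m n := by
  have h : ∀ i j, θ.mat j i = -θ.mat i j := fun i j => by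
    have := congrFun (congrFun θ.skew i) j
    simpa using this
  unfold SkewForm.form
  rw [Finset.sum_comm, ← Finset.sum_neg_distrib]
  refine Finset.sum_congr rfl fun i _ => ?_
  rw [← Finset.sum_neg_distrib]
  refine Finset.sum_congr rfl fun j _ => ?_
  rw [h i j]; ring

theorem SkewForm.form_add_left (θ : SkewForm ι) (m m' n : ι → ℤ) :
    θ.form (m + m') n = θ.form m n + θ.form m' n := by
  simp [SkewForm.form, add_mul, Finset.sum_add_distrib]

theorem SkewForm.form_add_right (θ : SkewForm ι) (m n n' : ι → ℤ) :
    θ.form m (n + n') = θ.form m n + θ.form m n' := by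
  simp [SkewForm.form, mul_add, Finset.sum_add_distrib]

theorem SkewForm.form_neg_left (θ : SkewForm ι) (m n : ι → ℤ) :
    θ.form (-m) n = -θ.form m n := by
  simp [SkewForm.form, Finset.sum_neg_distrib]

theorem SkewForm.form_neg_right (θ : SkewForm ι) (m n : ι → ℤ) :
    θ.form m (-n) = -θ.form m n := by
  simp [SkewForm.form, Finset.sum_neg_distrib]

theorem SkewForm.form_sub_right (θ : SkewForm ι) (m n n' : ι → ℤ) :
    θ.form m (n - n') = θ.form m n - θ.form m n' := by
  rw [sub_eq_add_neg, θ.form_add_right, θ.form_neg_right, sub_eq_add_neg]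

theorem SkewForm.form_sub_left (θ : SkewForm ι) (m m' n : ι → ℤ) :
    θ.form (m - m') n = θ.form m n - θ.form m' n := by
  rw [sub_eq_add_neg, θ.form_add_left, θ.form_neg_left, sub_eq_add_neg]

theorem SkewForm.form_self (θ : SkewForm ι) (m : ι → ℤ) : θ.form m m = 0 := by
  have := θ.form_swap m m; linarith

theorem SkewForm.form_zero_left (θ : SkewForm ι) (n : ι → ℤ) : θ.form 0 n = 0 := by
  simp [SkewForm.form]

theorem SkewForm.form_zero_right (θ : SkewForm ι) (n : ι → ℤ) : θ.form n 0 = 0 := by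
  simp [SkewForm.form]

/-- The cocycle `e^{(i/2) θ(m, n)}`. -/
def SkewForm.phase (θ : SkewForm ι) (m n : ι → ℤ) : ℂ :=
  Complex.exp (Complex.I / 2 * (θ.form m n : ℂ))

theorem SkewForm.norm_phase (θ : SkewForm ι) (m n : ι → ℤ) : ‖θ.phase m n‖ = 1 := by
  have : Complex.I / 2 * (θ.form m n : ℂ) = ((θ.form m n / 2 : ℝ) : ℂ) * Complex.I := by
    push_cast; ring
  rw [SkewForm.phase, this, Complex.norm_exp_ofReal_mul_I]

/-- The smooth part of the noncommutative torus: formal sums `∑ c_n U_n` over `n ∈ ℤ^ι` with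
rapidly decreasing coefficients `c_n`. -/
structure SmoothTorus (θ : SkewForm ι) where
  coeff : (ι → ℤ) → ℂ
  rapid : ∀ k : ℕ, Summable fun n : ι → ℤ => (1 + ‖n‖) ^ k * ‖coeff n‖

namespace SmoothTorus

variable {θ : SkewForm ι}

theorem summable_norm (a : SmoothTorus θ) : Summable fun n => ‖a.coeff n‖ := by
  simpa using a.rapid 0

theorem norm_le (a : SmoothTorus θ) (n : ι → ℤ) : ‖a.coeff n‖ ≤ ∑' m, ‖a.coeff m‖ :=
  a.summable_norm.le_tsum n fun _ _ => norm_nonneg _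

instance : Zero (SmoothTorus θ) := ⟨⟨0, fun k => by simp⟩⟩

instance : Add (SmoothTorus θ) := ⟨fun a b => ⟨a.coeff + b.coeff, fun k => by
  refine Summable.of_nonneg_of_le (fun n => by positivity) (fun n => ?_)
    ((a.rapid k).add (b.rapid k))
  rw [← mul_add]; gcongr; exact norm_add_le _ _⟩⟩

instance : Neg (SmoothTorus θ) := ⟨fun a => ⟨-a.coeff, fun k => by simpa using a.rapid k⟩⟩

instance : SMul ℂ (SmoothTorus θ) := ⟨fun c a => ⟨c • a.coeff, fun k => by
  refine ((a.rapid k).mul_left ‖c‖).congr fun n => ?_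
  rw [Pi.smul_apply, norm_smul]; ring⟩⟩

@[simp] theorem coeff_zero (n : ι → ℤ) : (0 : SmoothTorus θ).coeff n = 0 := rfl
@[simp] theorem coeff_add (a b : SmoothTorus θ) (n : ι → ℤ) :
    (a + b).coeff n = a.coeff n + b.coeff n := rfl
@[simp] theorem coeff_neg (a : SmoothTorus θ) (n : ι → ℤ) : (-a).coeff n = -a.coeff n := rfl
@[simp] theorem coeff_smul (c : ℂ) (a : SmoothTorus θ) (n : ι → ℤ) :
    (c • a).coeff n = c * a.coeff n := rfl

@[ext] theorem ext {a b : SmoothTorus θ} (h : ∀ n, a.coeff n = b.coeff n) : a = b := by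
  cases a; cases b; congr; exact funext h

instance : AddCommGroup (SmoothTorus θ) where
  add_assoc a b c := by ext n; simp [add_assoc]
  zero_add a := by ext n; simp
  add_zero a := by ext n; simp
  add_comm a b := by ext n; simp [add_comm]
  neg_add_cancel a := by ext n; simp
  nsmul := nsmulRec
  zsmul := zsmulRec

instance : Module ℂ (SmoothTorus θ) where
  one_smul a := by ext n; simp
  mul_smul c d a := by ext n; simp [mul_assoc]
  smul_zero c := by ext n; simp
  smul_add c a b := by ext n; simp [mul_add]
  add_smul c d a := by ext n; simp [add_mul]
  zero_smul a := by ext n; simp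

theorem weight_le (k n : ι → ℤ) : 1 + ‖n‖ ≤ (1 + ‖k‖) * (1 + ‖n - k‖) := by
  have : ‖n‖ ≤ ‖k‖ + ‖n - k‖ := by simpa using norm_add_le k (n - k)
  nlinarith [norm_nonneg k, norm_nonneg (n - k)]

theorem norm_term (a b : SmoothTorus θ) (n k : ι → ℤ) :
    ‖a.coeff k * b.coeff (n - k) * θ.phase k (n - k)‖ = ‖a.coeff k‖ * ‖b.coeff (n - k)‖ := by
  rw [norm_mul, norm_mul, θ.norm_phase, mul_one]

theorem summable_conv (a b : SmoothTorus θ) (p : ℕ) :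
    Summable fun x : (ι → ℤ) × (ι → ℤ) =>
      (1 + ‖x.1‖) ^ p * (‖a.coeff x.2‖ * ‖b.coeff (x.1 - x.2)‖) := by
  have h := (a.rapid p).mul_of_nonneg (b.rapid p) (fun n => by positivity) (fun n => by positivity)
  let e : (ι → ℤ) × (ι → ℤ) ≃ (ι → ℤ) × (ι → ℤ) :=
    { toFun := fun x => (x.2, x.1 - x.2), invFun := fun x => (x.1 + x.2, x.1)
      left_inv := fun x => by simp, right_inv := fun x => by simp }
  refine Summable.of_nonneg_of_le (fun x => by positivity) (fun x => ?_) (e.summable_iff.2 h)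
  simp only [e, Function.comp, Equiv.coe_fn_mk]
  calc _ ≤ ((1 + ‖x.2‖) * (1 + ‖x.1 - x.2‖)) ^ p * (‖a.coeff x.2‖ * ‖b.coeff (x.1 - x.2)‖) := by
        gcongr; exact weight_le _ _
    _ = _ := by rw [mul_pow]; ring

theorem summable_term_norm (a b : SmoothTorus θ) (n : ι → ℤ) :
    Summable fun k => ‖a.coeff k * b.coeff (n - k) * θ.phase k (n - k)‖ := by
  simp only [norm_term]
  simpa using (summable_conv a b 0).prod_factor n

theorem summable_term (a b : SmoothTorus θ) (n : ι → ℤ) :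
    Summable fun k => a.coeff k * b.coeff (n - k) * θ.phase k (n - k) :=
  (summable_term_norm a b n).of_norm

/-- The product determined by `U_m U_n = e^{(i/2) θ(m, n)} U_{m+n}`. -/
instance : Mul (SmoothTorus θ) := ⟨fun a b =>
  ⟨fun n => ∑' k, a.coeff k * b.coeff (n - k) * θ.phase k (n - k), fun p => by
    refine Summable.of_nonneg_of_le (fun n => by positivity) (fun n => ?_)
      (summable_conv a b p).prod
    dsimp only
    rw [tsum_mul_left]
    gcongr
    refine (norm_tsum_le_tsum_norm (summable_term_norm a b n)).trans (le_of_eq ?_)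
    simp only [norm_term]⟩⟩

theorem coeff_mul (a b : SmoothTorus θ) (n : ι → ℤ) :
    (a * b).coeff n = ∑' k, a.coeff k * b.coeff (n - k) * θ.phase k (n - k) := rfl

instance : One (SmoothTorus θ) := ⟨⟨Pi.single 0 1, fun p => by
  refine summable_of_ne_finset_zero (s := {0}) fun n hn => ?_
  rw [Finset.mem_singleton] at hn
  simp [Pi.single_eq_of_ne hn]⟩⟩

theorem coeff_one (n : ι → ℤ) :
    (1 : SmoothTorus θ).coeff n = (Pi.single 0 1 : (ι → ℤ) → ℂ) n := rfl

theorem phase_zero_left (n : ι → ℤ) : θ.phase 0 n = 1 := by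
  simp [SkewForm.phase, θ.form_zero_left]

theorem phase_zero_right (n : ι → ℤ) : θ.phase n 0 = 1 := by
  simp [SkewForm.phase, θ.form_zero_right]

theorem phase_assoc (k l m : ι → ℤ) :
    θ.phase k l * θ.phase (k + l) m = θ.phase k (l + m) * θ.phase l m := by
  simp only [SkewForm.phase, ← Complex.exp_add, θ.form_add_left, θ.form_add_right]
  congr 1; push_cast; ring

theorem assoc_aux (a b c : SmoothTorus θ) : a * b * c = a * (b * c) := by
  ext n
  simp only [coeff_mul]
  set F : (ι → ℤ) → (ι → ℤ) → ℂ := fun m k =>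
    a.coeff k * b.coeff (m - k) * θ.phase k (m - k) * c.coeff (n - m) * θ.phase m (n - m) with hF
  have hs : Summable (Function.uncurry F) := by
    refine Summable.of_norm_bounded (g := fun x : (ι → ℤ) × (ι → ℤ) =>
      (1 + ‖x.1‖) ^ 0 * (‖a.coeff x.2‖ * ‖b.coeff (x.1 - x.2)‖) * ∑' m, ‖c.coeff m‖)
      ((summable_conv a b 0).mul_right _) fun x => ?_
    rw [Function.uncurry, hF]
    dsimp only
    rw [norm_mul, norm_mul, norm_term, θ.norm_phase, pow_zero, one_mul, mul_one]
    gcongr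
    exact c.norm_le _
  calc ∑' m, (∑' k, a.coeff k * b.coeff (m - k) * θ.phase k (m - k)) * c.coeff (n - m)
          * θ.phase m (n - m) = ∑' m, ∑' k, F m k := by
        refine tsum_congr fun m => ?_
        rw [← tsum_mul_right, ← tsum_mul_right]
    _ = ∑' k, ∑' m, F m k := (hs.tsum_comm).symm
    _ = _ := by
        refine tsum_congr fun k => ?_
        rw [← (Equiv.addLeft k).tsum_eq, ← tsum_mul_left, ← tsum_mul_right]
        refine tsum_congr fun l => ?_
        have h := phase_assoc (θ := θ) k l (n - (k + l))
        rw [show l + (n - (k + l)) = n - k by abel] at h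
        simp only [hF, Equiv.coe_addLeft, add_sub_cancel_left]
        rw [show n - k - l = n - (k + l) by abel]
        linear_combination a.coeff k * b.coeff l * c.coeff (n - (k + l)) * h

theorem smul_mul_aux (t : ℂ) (a b : SmoothTorus θ) : t • a * b = t • (a * b) := by
  ext n
  simp only [coeff_mul, coeff_smul, ← tsum_mul_left]
  exact tsum_congr fun k => by ring

theorem mul_smul_aux (t : ℂ) (a b : SmoothTorus θ) : a * t • b = t • (a * b) := by
  ext n
  simp only [coeff_mul, coeff_smul, ← tsum_mul_left]
  exact tsum_congr fun k => by ring

instance : Ring (SmoothTorus θ) where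
  left_distrib a b c := by
    ext n
    simp only [coeff_mul, coeff_add, mul_add, add_mul]
    exact (summable_term a b n).tsum_add (summable_term a c n)
  right_distrib a b c := by
    ext n
    simp only [coeff_mul, coeff_add, add_mul]
    exact (summable_term a c n).tsum_add (summable_term b c n)
  zero_mul a := by ext n; simp [coeff_mul]
  mul_zero a := by ext n; simp [coeff_mul]
  mul_assoc := assoc_aux
  one_mul a := by
    ext n
    rw [coeff_mul, tsum_eq_single 0 fun k hk => by simp [coeff_one, Pi.single_eq_of_ne hk]]
    simp [coeff_one, phase_zero_left]
  mul_one a := by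
    ext n
    rw [coeff_mul, tsum_eq_single n fun k hk => by
      simp [coeff_one, Pi.single_eq_of_ne (sub_ne_zero.2 hk.symm)]]
    simp [coeff_one, phase_zero_right]
  neg_add_cancel a := neg_add_cancel a
  zsmul := zsmulRec

instance : Algebra ℂ (SmoothTorus θ) := Algebra.ofModule smul_mul_aux mul_smul_aux

/-- The involution determined by `(c U_n)^* = conj(c) U_{-n}`. -/
instance : Star (SmoothTorus θ) := ⟨fun a => ⟨fun n => starRingEnd ℂ (a.coeff (-n)), fun p => by
  refine ((Equiv.neg (ι → ℤ)).summable_iff.2 (a.rapid p)).congr fun n => ?_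
  simp⟩⟩

@[simp] theorem coeff_star (a : SmoothTorus θ) (n : ι → ℤ) :
    (star a).coeff n = starRingEnd ℂ (a.coeff (-n)) := rfl

theorem conj_phase (m n : ι → ℤ) : starRingEnd ℂ (θ.phase m n) = θ.phase n m := by
  rw [SkewForm.phase, ← Complex.exp_conj, SkewForm.phase, θ.form_swap m n]
  congr 1
  simp only [map_mul, map_div₀, Complex.conj_I, Complex.conj_ofReal, map_ofNat]
  push_cast; ring

instance : StarRing (SmoothTorus θ) where
  star_involutive a := by ext n; simp
  star_add a b := by ext n; simp
  star_mul a b := by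
    ext n
    simp only [coeff_star, coeff_mul]
    symm
    rw [Complex.conj_tsum, ← (Equiv.addLeft n).tsum_eq]
    refine tsum_congr fun k => ?_
    simp only [Equiv.coe_addLeft, map_mul, conj_phase]
    rw [show -(n - (n + k)) = k by abel, show -n - k = -(n + k) by abel,
      show n - (n + k) = -k by abel]
    have : θ.phase (-(n + k)) k = θ.phase (n + k) (-k) := by
      simp only [SkewForm.phase, θ.form_neg_left, θ.form_neg_right]
    rw [this]; ring

/-- The canonical trace `τ(∑ c_n U_n) = c_0`. -/
def trace (a : SmoothTorus θ) : ℂ := a.coeff 0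

/-- The infinitesimal automorphism `δ_v U_n = ⟨v, n⟩ U_n`, for `v` in the Lie algebra `ℝ^ι`.
It is spanned over `ℝ` by the `δ_l` with `δ_l U_{e_k} = δ_{lk} U_{e_k}`, and satisfies
`δ_v (a^*) = -(δ_v a)^*`. -/
def deriv (v : ι → ℝ) : SmoothTorus θ →ₗ[ℂ] SmoothTorus θ where
  toFun a := ⟨fun n => ((∑ i, v i * (n i : ℝ) : ℝ) : ℂ) * a.coeff n, fun p => by
    refine Summable.of_nonneg_of_le (fun n => by positivity) (fun n => ?_)
      ((a.rapid (p + 1)).mul_left (∑ i, |v i|))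
    have h : ‖((∑ i, v i * (n i : ℝ) : ℝ) : ℂ)‖ ≤ (∑ i, |v i|) * (1 + ‖n‖) := by
      rw [Complex.norm_real, Finset.sum_mul]
      refine (norm_sum_le _ _).trans (Finset.sum_le_sum fun i _ => ?_)
      rw [norm_mul, Real.norm_eq_abs]
      gcongr
      have := norm_le_pi_norm n i
      rw [Int.norm_eq_abs] at this
      rw [Real.norm_eq_abs]; linarith
    rw [norm_mul, pow_succ]
    calc _ ≤ (1 + ‖n‖) ^ p * ((∑ i, |v i|) * (1 + ‖n‖) * ‖a.coeff n‖) := by gcongr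
      _ = _ := by ring⟩
  map_add' a b := by ext n; simp [mul_add]
  map_smul' c a := by ext n; simp; ring

theorem coeff_deriv (v : ι → ℝ) (a : SmoothTorus θ) (n : ι → ℤ) :
    (deriv v a).coeff n = ((∑ i, v i * (n i : ℝ) : ℝ) : ℂ) * a.coeff n := rfl

/-- The `ℓ²` (GNS) norm `τ(a^* a)^{1/2}`. -/
def l2norm (a : SmoothTorus θ) : ℝ := Real.sqrt (∑' n, ‖a.coeff n‖ ^ 2)

/-- The `C^*`-norm: the norm of left multiplication by `a` on `ℓ²(ℤ^ι)`. -/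
def cstarNorm (a : SmoothTorus θ) : ℝ :=
  sInf {C : ℝ | 0 ≤ C ∧ ∀ x : SmoothTorus θ, l2norm (a * x) ≤ C * l2norm x}

/-- Positivity in the `C^*`-algebra: `a` is selfadjoint and left multiplication by `a` is a
positive operator on `ℓ²(ℤ^ι)`. -/
def IsPositive (a : SmoothTorus θ) : Prop :=
  star a = a ∧ ∀ x : SmoothTorus θ, 0 ≤ (trace (star x * a * x)).re

/-! ### Subtori -/

section push

variable {κ : Type} [Fintype κ] {η : SkewForm κ}

theorem push_injective {φ : (κ → ℤ) →+ (ι → ℤ)} (hφ : ∀ n, ‖φ n‖ = ‖n‖) :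
    Function.Injective φ :=
  (injective_iff_map_eq_zero φ).2 fun n hn => by
    have := hφ n
    rw [hn, norm_zero] at this
    exact norm_eq_zero.1 this.symm

theorem push_rapid {φ : (κ → ℤ) →+ (ι → ℤ)} (hφ : ∀ n, ‖φ n‖ = ‖n‖) (a : SmoothTorus η) (p : ℕ) :
    Summable fun n : ι → ℤ => (1 + ‖n‖) ^ p * ‖Function.extend φ a.coeff (fun _ => 0) n‖ := by
  rw [← (push_injective hφ).summable_iff]
  · refine (a.rapid p).congr fun k => ?_
    rw [Function.comp_apply, (push_injective hφ).extend_apply, hφ]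
  · intro n hn
    rw [Function.extend_apply' _ _ _ fun ⟨k, hk⟩ => hn ⟨k, hk⟩, norm_zero, mul_zero]

/-- For a norm preserving homomorphism `φ : ℤ^κ → ℤ^ι`, the linear map `U_n ↦ U_{φ n}`. -/
def push (θ : SkewForm ι) (φ : (κ → ℤ) →+ (ι → ℤ)) (hφ : ∀ n, ‖φ n‖ = ‖n‖) :
    SmoothTorus η →ₗ[ℂ] SmoothTorus θ where
  toFun a := ⟨Function.extend φ a.coeff (fun _ => 0), push_rapid hφ a⟩
  map_add' a b := by
    refine SmoothTorus.ext fun n => ?_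
    change Function.extend φ (fun k => a.coeff k + b.coeff k) (fun _ => 0) n
      = Function.extend φ a.coeff (fun _ => 0) n + Function.extend φ b.coeff (fun _ => 0) n
    by_cases hn : ∃ k, φ k = n
    · obtain ⟨k, rfl⟩ := hn
      simp only [(push_injective hφ).extend_apply]
    · simp only [Function.extend_apply' _ _ _ hn, add_zero]
  map_smul' c a := by
    refine SmoothTorus.ext fun n => ?_
    change Function.extend φ (fun k => c * a.coeff k) (fun _ => 0) n
      = c * Function.extend φ a.coeff (fun _ => 0) n
    by_cases hn : ∃ k, φ k = n
    · obtain ⟨k, rfl⟩ := hn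
      simp only [(push_injective hφ).extend_apply]
    · simp only [Function.extend_apply' _ _ _ hn, mul_zero]

variable {φ : (κ → ℤ) →+ (ι → ℤ)} {hφ : ∀ n, ‖φ n‖ = ‖n‖}

theorem coeff_push (a : SmoothTorus η) (k : κ → ℤ) :
    (push θ φ hφ a).coeff (φ k) = a.coeff k :=
  (push_injective hφ).extend_apply a.coeff (fun _ => 0) k

theorem coeff_push' (a : SmoothTorus η) (n : ι → ℤ) (hn : n ∉ Set.range φ) :
    (push θ φ hφ a).coeff n = 0 :=
  Function.extend_apply' a.coeff (fun _ => 0) n hn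

theorem coeff_push_mul (a : SmoothTorus η) (x : SmoothTorus θ) (n : ι → ℤ) :
    (push θ φ hφ a * x).coeff n
      = ∑' k, a.coeff k * x.coeff (n - φ k) * θ.phase (φ k) (n - φ k) := by
  rw [coeff_mul, ← (push_injective hφ).tsum_eq]
  · simp only [coeff_push]
  · intro m hm
    by_contra h
    exact hm (by simp [coeff_push' a m h])

theorem coeff_mul_push (a : SmoothTorus η) (x : SmoothTorus θ) (n : ι → ℤ) :
    (x * push θ φ hφ a).coeff n
      = ∑' k, x.coeff (n - φ k) * a.coeff k * θ.phase (n - φ k) (φ k) := by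
  rw [coeff_mul, ← (Equiv.subLeft n).tsum_eq, ← (push_injective hφ).tsum_eq]
  · simp only [coeff_push, Equiv.subLeft_apply, sub_sub_cancel]
  · intro m hm
    by_contra h
    exact hm (by simp [coeff_push' a m h])

theorem push_mul_push (a b : SmoothTorus η) (h : ∀ k l, θ.phase (φ k) (φ l) = η.phase k l) :
    push θ φ hφ a * push θ φ hφ b = push θ φ hφ (a * b) := by
  ext n
  rw [coeff_push_mul]
  by_cases hn : n ∈ Set.range φ
  · obtain ⟨m, rfl⟩ := hn
    rw [coeff_push, coeff_mul]
    refine tsum_congr fun k => ?_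
    rw [← map_sub, coeff_push, h]
  · rw [coeff_push' _ _ hn]
    refine (tsum_congr fun k => ?_).trans tsum_zero
    rw [coeff_push' b (n - φ k) fun ⟨l, hl⟩ => hn ⟨l + k, by rw [map_add, hl]; abel⟩]
    ring

theorem push_mul_push_op (a b : SmoothTorus η) (h : ∀ k l, θ.phase (φ k) (φ l) = η.phase l k) :
    push θ φ hφ a * push θ φ hφ b = push θ φ hφ (b * a) := by
  ext n
  rw [coeff_push_mul]
  by_cases hn : n ∈ Set.range φ
  · obtain ⟨m, rfl⟩ := hn
    rw [coeff_push, coeff_mul, ← (Equiv.subLeft m).tsum_eq]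
    refine tsum_congr fun k => ?_
    simp only [Equiv.subLeft_apply]
    rw [← map_sub, coeff_push, h, sub_sub_cancel]
    ring
  · rw [coeff_push' _ _ hn]
    refine (tsum_congr fun k => ?_).trans tsum_zero
    rw [coeff_push' b (n - φ k) fun ⟨l, hl⟩ => hn ⟨l + k, by rw [map_add, hl]; abel⟩]
    ring

theorem push_one : push θ φ hφ (1 : SmoothTorus η) = 1 := by
  ext n
  by_cases hn : n ∈ Set.range φ
  · obtain ⟨m, rfl⟩ := hn
    rw [coeff_push, coeff_one, coeff_one]
    by_cases hm : m = 0
    · subst hm; simp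
    · rw [Pi.single_eq_of_ne hm, Pi.single_eq_of_ne]
      exact fun h => hm (push_injective hφ (by rw [h, map_zero]))
  · rw [coeff_push' _ _ hn, coeff_one, Pi.single_eq_of_ne]
    rintro rfl
    exact hn ⟨0, map_zero _⟩

theorem push_star (a : SmoothTorus η) : push θ φ hφ (star a) = star (push θ φ hφ a) := by
  ext n
  by_cases hn : n ∈ Set.range φ
  · obtain ⟨m, rfl⟩ := hn
    rw [coeff_push, coeff_star, coeff_star, ← map_neg, coeff_push]
  · rw [coeff_push' _ _ hn, coeff_star, coeff_push' a (-n) fun ⟨l, hl⟩ =>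
      hn ⟨-l, by rw [map_neg, hl, neg_neg]⟩, map_zero]

end push

end SmoothTorus

section product

open SmoothTorus

variable {κ : Type} [Fintype κ]

/-- The form `θ ⊕ (-θ')`. -/
def SkewForm.diff (θ : SkewForm ι) (θ' : SkewForm κ) : SkewForm (ι ⊕ κ) where
  mat := Matrix.fromBlocks θ.mat 0 0 (-θ'.mat)
  skew := by
    rw [Matrix.fromBlocks_transpose, Matrix.fromBlocks_neg, θ.skew, Matrix.transpose_neg, θ'.skew]
    simp

theorem SkewForm.form_diff (θ : SkewForm ι) (θ' : SkewForm κ) (m m' : ι → ℤ) (n n' : κ → ℤ) :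
    (θ.diff θ').form (Sum.elim m n) (Sum.elim m' n') = θ.form m m' - θ'.form n n' := by
  simp [SkewForm.form, SkewForm.diff, Fintype.sum_sum_type, sub_eq_add_neg]

/-- The inclusion `m ↦ (m, 0)`. -/
def inlHom (ι κ : Type) : (ι → ℤ) →+ (ι ⊕ κ → ℤ) where
  toFun m := Sum.elim m 0
  map_zero' := by ext x; cases x <;> rfl
  map_add' m n := by ext x; cases x <;> simp

/-- The inclusion `n ↦ (0, n)`. -/
def inrHom (ι κ : Type) : (κ → ℤ) →+ (ι ⊕ κ → ℤ) where
  toFun n := Sum.elim 0 n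
  map_zero' := by ext x; cases x <;> rfl
  map_add' m n := by ext x; cases x <;> simp

theorem norm_inlHom (m : ι → ℤ) : ‖inlHom ι κ m‖ = ‖m‖ := by
  refine le_antisymm ((pi_norm_le_iff_of_nonneg (norm_nonneg _)).2 ?_)
    ((pi_norm_le_iff_of_nonneg (norm_nonneg _)).2 fun i => norm_le_pi_norm (inlHom ι κ m) (Sum.inl i))
  rintro (i | i)
  · exact norm_le_pi_norm m i
  · simp [inlHom]

theorem norm_inrHom (n : κ → ℤ) : ‖inrHom ι κ n‖ = ‖n‖ := by
  refine le_antisymm ((pi_norm_le_iff_of_nonneg (norm_nonneg _)).2 ?_)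
    ((pi_norm_le_iff_of_nonneg (norm_nonneg _)).2 fun i => norm_le_pi_norm (inrHom ι κ n) (Sum.inr i))
  rintro (i | i)
  · simp [inrHom]
  · exact norm_le_pi_norm n i

theorem phase_inl (θ : SkewForm ι) (θ' : SkewForm κ) (k l : ι → ℤ) :
    (θ.diff θ').phase (inlHom ι κ k) (inlHom ι κ l) = θ.phase k l := by
  simp [SkewForm.phase, inlHom, SkewForm.form_diff, θ'.form_zero_left]

theorem phase_inr (θ : SkewForm ι) (θ' : SkewForm κ) (k l : κ → ℤ) :
    (θ.diff θ').phase (inrHom ι κ k) (inrHom ι κ l) = θ'.phase l k := by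
  simp [SkewForm.phase, inrHom, SkewForm.form_diff, θ.form_zero_left, θ'.form_swap k l]

variable (θ : SkewForm ι) (θ' : SkewForm κ)

/-- The inclusion `A_θ → A_{θ ⊕ (-θ')}`, `U_m ↦ U_{(m, 0)}`. -/
def embL : SmoothTorus θ →ₐ[ℂ] SmoothTorus (θ.diff θ') :=
  AlgHom.ofLinearMap (push _ (inlHom ι κ) norm_inlHom)
    (push_one (hφ := norm_inlHom)) fun a b =>
      (push_mul_push (hφ := norm_inlHom) a b (phase_inl θ θ')).symm

/-- The inclusion of the opposite algebra of `A_θ'` into `A_{θ ⊕ (-θ')}`, `U_n ↦ U_{(0, n)}`: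
through it a left `A_{θ ⊕ (-θ')}`-module is a right `A_θ'`-module. -/
def embR : (SmoothTorus θ')ᵐᵒᵖ →ₐ[ℂ] SmoothTorus (θ.diff θ') :=
  AlgHom.ofLinearMap
    (push (θ.diff θ') (inrHom ι κ) norm_inrHom ∘ₗ (MulOpposite.opLinearEquiv ℂ).symm.toLinearMap)
    (push_one (hφ := norm_inrHom)) fun a b =>
      (push_mul_push_op (hφ := norm_inrHom) a.unop b.unop (phase_inr θ θ')).symm

/-- The partial trace `τ_θ ⊗ id : A_{θ ⊕ (-θ')} → A_θ'`, with values in `A_θ'` through the linear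
identification `U_{(0, n)} ↔ U_n`. -/
def ptrace : SmoothTorus (θ.diff θ') →ₗ[ℂ] SmoothTorus θ' where
  toFun a := ⟨fun n => a.coeff (inrHom ι κ n), fun p =>
    ((a.rapid p).comp_injective (push_injective norm_inrHom)).congr fun n => by
      simp [norm_inrHom]⟩
  map_add' a b := rfl
  map_smul' c a := rfl

theorem coeff_ptrace (a : SmoothTorus (θ.diff θ')) (n : κ → ℤ) :
    (ptrace θ θ' a).coeff n = a.coeff (inrHom ι κ n) := rfl

theorem embL_apply (a : SmoothTorus θ) :
    embL θ θ' a = push (θ.diff θ') (inlHom ι κ) norm_inlHom a := rfl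

theorem embR_apply (b : (SmoothTorus θ')ᵐᵒᵖ) :
    embR θ θ' b = push (θ.diff θ') (inrHom ι κ) norm_inrHom b.unop := rfl

theorem embL_star (a : SmoothTorus θ) : embL θ θ' (star a) = star (embL θ θ' a) :=
  push_star (hφ := norm_inlHom) a

theorem embL_comm_embR (a : SmoothTorus θ) (b : (SmoothTorus θ')ᵐᵒᵖ) :
    embL θ θ' a * embR θ θ' b = embR θ θ' b * embL θ θ' a := by
  ext n
  rw [embL_apply, embR_apply, coeff_push_mul, coeff_mul_push]
  refine tsum_congr fun k => ?_
  by_cases hn : n - inlHom ι κ k ∈ Set.range (inrHom ι κ)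
  · obtain ⟨l, hl⟩ := hn
    rw [← hl, coeff_push]
    have h1 : (θ.diff θ').phase (inlHom ι κ k) (inrHom ι κ l) = 1 := by
      simp [SkewForm.phase, inlHom, inrHom, SkewForm.form_diff, θ.form_zero_right,
        θ'.form_zero_left]
    have h2 : (θ.diff θ').phase (inrHom ι κ l) (inlHom ι κ k) = 1 := by
      simp [SkewForm.phase, inlHom, inrHom, SkewForm.form_diff, θ.form_zero_left,
        θ'.form_zero_right]
    rw [h1, h2]; ring
  · rw [coeff_push' _ _ hn]; ring

theorem ptrace_comm (a : SmoothTorus θ) (x : SmoothTorus (θ.diff θ')) :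
    ptrace θ θ' (embL θ θ' a * x) = ptrace θ θ' (x * embL θ θ' a) := by
  ext n
  rw [coeff_ptrace, coeff_ptrace, embL_apply, coeff_push_mul, coeff_mul_push]
  refine tsum_congr fun k => ?_
  have h : (θ.diff θ').phase (inlHom ι κ k) (inrHom ι κ n - inlHom ι κ k)
      = (θ.diff θ').phase (inrHom ι κ n - inlHom ι κ k) (inlHom ι κ k) := by
    simp only [SkewForm.phase, SkewForm.form_sub_right, SkewForm.form_sub_left]
    simp [inlHom, inrHom, SkewForm.form_diff, θ.form_zero_left, θ.form_zero_right,
      θ'.form_zero_left, θ'.form_zero_right]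
  rw [h]; ring

theorem deriv_embL (u : ι → ℝ) (v : κ → ℝ) (a : SmoothTorus θ) :
    deriv (Sum.elim u v) (embL θ θ' a) = embL θ θ' (deriv u a) := by
  ext n
  rw [coeff_deriv, embL_apply, embL_apply]
  by_cases hn : n ∈ Set.range (inlHom ι κ)
  · obtain ⟨m, rfl⟩ := hn
    rw [coeff_push, coeff_push, coeff_deriv]
    simp [inlHom, Fintype.sum_sum_type]
  · rw [coeff_push' _ _ hn, coeff_push' _ _ hn, mul_zero]

theorem deriv_embR (u : ι → ℝ) (v : κ → ℝ) (b : (SmoothTorus θ')ᵐᵒᵖ) :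
    deriv (Sum.elim u v) (embR θ θ' b) = embR θ θ' (MulOpposite.op (deriv v b.unop)) := by
  ext n
  rw [coeff_deriv, embR_apply, embR_apply]
  by_cases hn : n ∈ Set.range (inrHom ι κ)
  · obtain ⟨m, rfl⟩ := hn
    rw [coeff_push, coeff_push, MulOpposite.unop_op, coeff_deriv]
    simp [inrHom, Fintype.sum_sum_type]
  · rw [coeff_push' _ _ hn, coeff_push' _ _ hn, mul_zero]

end product
end torus

open scoped TensorProduct
open SmoothTorus MulOpposite

/-! ### Hermitian modules and connections -/

section modules

variable {ι : Type} [Fintype ι]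

/-- A Hermitian structure on a right `A_θ`-module: a positive definite `A_θ`-valued inner product,
conjugate linear in the first and linear in the second variable. -/
structure HermitianForm (θ : SkewForm ι) (R : Type*) [AddCommGroup R]
    [Module (SmoothTorus θ)ᵐᵒᵖ R] where
  inner : R → R → SmoothTorus θ
  inner_add_right : ∀ x y z, inner x (y + z) = inner x y + inner x z
  inner_smul_right : ∀ x y a, inner x (op a • y) = inner x y * a
  star_inner : ∀ x y, star (inner x y) = inner y x
  inner_pos : ∀ x, IsPositive (inner x x)
  definite : ∀ x, inner x x = 0 → x = 0

/-- `R` is a finitely generated projective Hermitian module: it has a finite frame `u_i`, with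
`y = ∑ u_i ⟨u_i, y⟩`. Equivalently, `R` is isometric to `p A_θ^n`, with the standard inner product
`∑ x_i^* y_i`, for a selfadjoint projection `p`, namely the matrix `p = (⟨u_i, u_j⟩)`. -/
def HermitianForm.IsProjective {θ : SkewForm ι} {R : Type*} [AddCommGroup R]
    [Module (SmoothTorus θ)ᵐᵒᵖ R] (h : HermitianForm θ R) : Prop :=
  ∃ (n : ℕ) (u : Fin n → R), ∀ y, y = ∑ i, op (h.inner (u i) y) • u i

/-- A Hermitian `A_θ`-connection on a right module. As `δ_v (a^*) = -(δ_v a)^*`, compatibility with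
the inner product says that the `∇_v` are selfadjoint rather than skew. -/
structure Connection {θ : SkewForm ι} {R : Type*} [AddCommGroup R] [Module ℂ R]
    [Module (SmoothTorus θ)ᵐᵒᵖ R] (h : HermitianForm θ R) where
  nabla : (ι → ℝ) → R →ₗ[ℂ] R
  nabla_add : ∀ v w, nabla (v + w) = nabla v + nabla w
  nabla_smul : ∀ (c : ℝ) v, nabla (c • v) = (c : ℂ) • nabla v
  leibniz : ∀ v (a : SmoothTorus θ) x, nabla v (op a • x) = op a • nabla v x + op (deriv v a) • x
  compatible : ∀ v x y, deriv v (h.inner x y) = h.inner x (nabla v y) - h.inner (nabla v x) y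

/-- A Hermitian structure on a left `A_θ`-module, linear in the first variable. -/
structure LeftHermitianForm (θ : SkewForm ι) (P : Type*) [AddCommGroup P]
    [Module (SmoothTorus θ) P] where
  inner : P → P → SmoothTorus θ
  inner_add_left : ∀ x y z, inner (x + y) z = inner x z + inner y z
  inner_smul_left : ∀ a x y, inner (a • x) y = a * inner x y
  star_inner : ∀ x y, star (inner x y) = inner y x
  inner_pos : ∀ x, IsPositive (inner x x)
  definite : ∀ x, inner x x = 0 → x = 0

/-- Finitely generated projective Hermitian left modules. -/
def LeftHermitianForm.IsProjective {θ : SkewForm ι} {P : Type*} [AddCommGroup P]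
    [Module (SmoothTorus θ) P] (h : LeftHermitianForm θ P) : Prop :=
  ∃ (n : ℕ) (u : Fin n → P), ∀ y, y = ∑ i, h.inner y (u i) • u i

/-- A Hermitian `A_θ`-connection on a left module. -/
structure LeftConnection {θ : SkewForm ι} {P : Type*} [AddCommGroup P] [Module ℂ P]
    [Module (SmoothTorus θ) P] (h : LeftHermitianForm θ P) where
  nabla : (ι → ℝ) → P →ₗ[ℂ] P
  nabla_add : ∀ v w, nabla (v + w) = nabla v + nabla w
  nabla_smul : ∀ (c : ℝ) v, nabla (c • v) = (c : ℂ) • nabla v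
  leibniz : ∀ v (a : SmoothTorus θ) x, nabla v (a • x) = a • nabla v x + deriv v a • x
  compatible : ∀ v x y, deriv v (h.inner x y) = h.inner (nabla v x) y - h.inner x (nabla v y)

/-- The commutator of two operators; for a connection, `[∇_v, ∇_w]` is its curvature, as the Lie
algebra `ℝ^ι` is commutative. -/
def opCommutator {E : Type*} [AddCommGroup E] [Module ℂ E] (S T : E →ₗ[ℂ] E) : E →ₗ[ℂ] E :=
  S ∘ₗ T - T ∘ₗ S

end modules

/-! ### The tensor product `R ⊗_{A_θ} P` -/

section tensor

variable {ι κ : Type} [Fintype ι] [Fintype κ] (θ : SkewForm ι) (θ' : SkewForm κ)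
variable (R P : Type*) [AddCommGroup R] [Module ℂ R] [Module (SmoothTorus θ)ᵐᵒᵖ R]
  [AddCommGroup P] [Module ℂ P] [Module (SmoothTorus (θ.diff θ')) P]

/-- The relations `ra ⊗ p = r ⊗ ap`, `a ∈ A_θ`. -/
def balancing : Submodule ℂ (R ⊗[ℂ] P) :=
  Submodule.span ℂ {t | ∃ (r : R) (a : SmoothTorus θ) (p : P),
    t = (op a • r) ⊗ₜ[ℂ] p - r ⊗ₜ[ℂ] (embL θ θ' a • p)}

/-- The tensor product `R ⊗_{A_θ} P` of a right `A_θ`-module and a left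
`A_{θ ⊕ (-θ')}`-module. -/
def BalTensor : Type _ := (R ⊗[ℂ] P) ⧸ balancing θ θ' R P

instance : AddCommGroup (BalTensor θ θ' R P) :=
  inferInstanceAs (AddCommGroup ((R ⊗[ℂ] P) ⧸ balancing θ θ' R P))

instance : Module ℂ (BalTensor θ θ' R P) :=
  inferInstanceAs (Module ℂ ((R ⊗[ℂ] P) ⧸ balancing θ θ' R P))

namespace BalTensor

variable {R P}

/-- The quotient map `R ⊗ P → R ⊗_{A_θ} P`. -/
def proj : R ⊗[ℂ] P →ₗ[ℂ] BalTensor θ θ' R P := (balancing θ θ' R P).mkQ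

/-- The bilinear map `(r, p) ↦ r ⊗ p`. -/
def mk : R →ₗ[ℂ] P →ₗ[ℂ] BalTensor θ θ' R P := (TensorProduct.mk ℂ R P).compr₂ (proj θ θ')

/-- The class of `r ⊗ p`. -/
def tmul (r : R) (p : P) : BalTensor θ θ' R P := mk θ θ' r p

theorem balance (r : R) (a : SmoothTorus θ) (p : P) :
    tmul θ θ' (op a • r) p = tmul θ θ' r (embL θ θ' a • p) :=
  (Submodule.Quotient.eq _).2 (Submodule.subset_span ⟨r, a, p, rfl⟩)

theorem tmul_add (r : R) (p q : P) :
    tmul θ θ' r (p + q) = tmul θ θ' r p + tmul θ θ' r q := map_add (mk θ θ' r) p q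

theorem add_tmul (r s : R) (p : P) :
    tmul θ θ' (r + s) p = tmul θ θ' r p + tmul θ θ' s p := LinearMap.map_add₂ (mk θ θ') r s p

theorem tmul_smul (c : ℂ) (r : R) (p : P) :
    tmul θ θ' r (c • p) = c • tmul θ θ' r p := map_smul (mk θ θ' r) c p

theorem tmul_zero (r : R) : tmul θ θ' r (0 : P) = 0 := map_zero (mk θ θ' r)

variable {θ θ'}

theorem hom_ext {M : Type*} [AddCommGroup M] [Module ℂ M] {f g : BalTensor θ θ' R P →ₗ[ℂ] M}
    (h : ∀ r p, f (tmul θ θ' r p) = g (tmul θ θ' r p)) : f = g :=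
  Submodule.linearMap_qext _ (TensorProduct.ext' h)

variable (θ θ')

/-- The linear map on `R ⊗_{A_θ} P` defined by a balanced bilinear map. -/
def lift {M : Type*} [AddCommGroup M] [Module ℂ M] (f : R →ₗ[ℂ] P →ₗ[ℂ] M)
    (hf : ∀ r a p, f (op a • r) p = f r (embL θ θ' a • p)) : BalTensor θ θ' R P →ₗ[ℂ] M :=
  (balancing θ θ' R P).liftQ (TensorProduct.lift f) <| Submodule.span_le.2 <| by
    rintro _ ⟨r, a, p, rfl⟩
    simp [hf]

@[simp] theorem lift_tmul {M : Type*} [AddCommGroup M] [Module ℂ M] (f : R →ₗ[ℂ] P →ₗ[ℂ] M)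
    (hf : ∀ r a p, f (op a • r) p = f r (embL θ θ' a • p)) (r : R) (p : P) :
    lift θ θ' f hf (tmul θ θ' r p) = f r p := rfl

variable [IsScalarTower ℂ (SmoothTorus (θ.diff θ')) P]

/-- Multiplication by an element of `A_{θ ⊕ (-θ')}` on `P`. -/
def mulP (c : SmoothTorus (θ.diff θ')) : P →ₗ[ℂ] P where
  toFun p := c • p
  map_add' := smul_add c
  map_smul' t p := smul_comm c t p

/-- The right action of `A_θ'` on `R ⊗_{A_θ} P`: `(r ⊗ p) b = r ⊗ (p b)`. -/
def rightMul (b : (SmoothTorus θ')ᵐᵒᵖ) : BalTensor θ θ' R P →ₗ[ℂ] BalTensor θ θ' R P :=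
  lift θ θ' ((mk θ θ').compl₂ (mulP θ θ' (embR θ θ' b))) fun r a p => by
    change tmul θ θ' (op a • r) (embR θ θ' b • p) = tmul θ θ' r (embR θ θ' b • embL θ θ' a • p)
    rw [balance, smul_smul, smul_smul, embL_comm_embR]

@[simp] theorem rightMul_tmul (b : (SmoothTorus θ')ᵐᵒᵖ) (r : R) (p : P) :
    rightMul θ θ' b (tmul θ θ' r p) = tmul θ θ' r (embR θ θ' b • p) := rfl

/-- The right action as a homomorphism. -/
def rightMulHom : (SmoothTorus θ')ᵐᵒᵖ →+* Module.End ℂ (BalTensor θ θ' R P) where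
  toFun := rightMul θ θ'
  map_one' := hom_ext fun r p => by simp
  map_mul' b c := hom_ext fun r p => by
    rw [Module.End.mul_apply, rightMul_tmul, rightMul_tmul, rightMul_tmul, map_mul, mul_smul]
  map_zero' := hom_ext fun r p => by
    rw [rightMul_tmul, map_zero, zero_smul, LinearMap.zero_apply]
    exact tmul_zero θ θ' r
  map_add' b c := hom_ext fun r p => by
    rw [LinearMap.add_apply, rightMul_tmul, rightMul_tmul, rightMul_tmul, map_add, add_smul,
      tmul_add]

instance : Module (SmoothTorus θ')ᵐᵒᵖ (BalTensor θ θ' R P) :=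
  Module.compHom _ (rightMulHom (R := R) (P := P) θ θ')

theorem op_smul_tmul (b : (SmoothTorus θ')ᵐᵒᵖ) (r : R) (p : P) :
    b • tmul θ θ' r p = tmul θ θ' r (embR θ θ' b • p) := rfl

/-- Multiplication by `b` is `ℂ`-linear. -/
theorem op_smul_def (b : (SmoothTorus θ')ᵐᵒᵖ) (x : BalTensor θ θ' R P) :
    b • x = rightMul θ θ' b x := rfl

instance : IsScalarTower ℂ (SmoothTorus θ')ᵐᵒᵖ (BalTensor θ θ' R P) where
  smul_assoc c b x := by
    have h : rightMul θ θ' (c • b) = c • rightMul (R := R) (P := P) θ θ' b :=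
      hom_ext fun r p => by
        rw [LinearMap.smul_apply, rightMul_tmul, rightMul_tmul, map_smul, smul_assoc, tmul_smul]
    exact LinearMap.congr_fun h x

end BalTensor

end tensor

/-! ### The inner product and the connections on `R ⊗_{A_θ} P` -/

section structures

open BalTensor

variable {ι κ : Type} [Fintype ι] [Fintype κ] {θ : SkewForm ι} {θ' : SkewForm κ}
variable {R P : Type*} [AddCommGroup R] [Module ℂ R] [Module (SmoothTorus θ)ᵐᵒᵖ R]
  [AddCommGroup P] [Module ℂ P] [Module (SmoothTorus (θ.diff θ')) P]

namespace HermitianForm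

variable (h : HermitianForm θ R)

theorem inner_add_left (x y z : R) : h.inner (x + y) z = h.inner x z + h.inner y z := by
  rw [← h.star_inner, h.inner_add_right, star_add, h.star_inner, h.star_inner]

theorem inner_smul_left (x y : R) (a : SmoothTorus θ) :
    h.inner (op a • x) y = star a * h.inner x y := by
  rw [← h.star_inner, h.inner_smul_right, star_mul, h.star_inner]

theorem inner_csmul_right [IsScalarTower ℂ (SmoothTorus θ)ᵐᵒᵖ R] (c : ℂ) (x y : R) :
    h.inner x (c • y) = c • h.inner x y := by
  have : c • y = op (c • (1 : SmoothTorus θ)) • y := by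
    rw [op_smul, smul_assoc, op_one, one_smul]
  rw [this, h.inner_smul_right, mul_smul_comm, mul_one]

theorem inner_csmul_left [IsScalarTower ℂ (SmoothTorus θ)ᵐᵒᵖ R] (c : ℂ) (x y : R) :
    h.inner (c • x) y = starRingEnd ℂ c • h.inner x y := by
  rw [← h.star_inner, h.inner_csmul_right, ← h.star_inner y x]
  ext n
  simp

end HermitianForm

namespace LeftHermitianForm

variable (h : LeftHermitianForm (θ.diff θ') P)

theorem inner_add_right (x y z : P) : h.inner x (y + z) = h.inner x y + h.inner x z := by
  rw [← h.star_inner, h.inner_add_left, star_add, h.star_inner, h.star_inner]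

theorem inner_smul_right (a : SmoothTorus (θ.diff θ')) (x y : P) :
    h.inner x (a • y) = h.inner x y * star a := by
  rw [← h.star_inner, h.inner_smul_left, star_mul, h.star_inner]

variable [IsScalarTower ℂ (SmoothTorus (θ.diff θ')) P]

theorem inner_csmul_left (c : ℂ) (x y : P) : h.inner (c • x) y = c • h.inner x y := by
  have : c • x = (c • (1 : SmoothTorus (θ.diff θ'))) • x := by rw [smul_assoc, one_smul]
  rw [this, h.inner_smul_left, smul_mul_assoc, one_mul]

theorem inner_csmul_right (c : ℂ) (x y : P) :
    h.inner x (c • y) = starRingEnd ℂ c • h.inner x y := by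
  rw [← h.star_inner, h.inner_csmul_left, ← h.star_inner y x]
  ext n
  simp

end LeftHermitianForm

variable [IsScalarTower ℂ (SmoothTorus θ)ᵐᵒᵖ R] [IsScalarTower ℂ (SmoothTorus (θ.diff θ')) P]
variable (hR : HermitianForm θ R) (hP : LeftHermitianForm (θ.diff θ') P)

/-- The `A_θ'`-valued inner product on simple tensors,
`⟨r ⊗ p, r' ⊗ p'⟩ = (τ_θ ⊗ id) {⟨r, r'⟩ p', p}`, as a function of the second argument. -/
def innerSimple (r : R) (p : P) : BalTensor θ θ' R P →ₗ[ℂ] SmoothTorus θ' :=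
  BalTensor.lift θ θ'
    (LinearMap.mk₂ ℂ (fun r' p' => ptrace θ θ' (hP.inner (embL θ θ' (hR.inner r r') • p') p))
      (fun r₁ r₂ p' => by
        rw [hR.inner_add_right, map_add, add_smul, hP.inner_add_left, map_add])
      (fun c r' p' => by
        rw [hR.inner_csmul_right, map_smul, smul_assoc, hP.inner_csmul_left, map_smul])
      (fun r' p₁ p₂ => by rw [smul_add, hP.inner_add_left, map_add])
      (fun c r' p' => by rw [smul_comm, hP.inner_csmul_left, map_smul]))
    fun r' a p' => by
      rw [LinearMap.mk₂_apply, LinearMap.mk₂_apply, hR.inner_smul_right, map_mul, mul_smul]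

theorem innerSimple_tmul (r r' : R) (p p' : P) :
    innerSimple hR hP r p (tmul θ θ' r' p')
      = ptrace θ θ' (hP.inner (embL θ θ' (hR.inner r r') • p') p) := rfl

/-- The `A_θ'`-valued inner product on `R ⊗_{A_θ} P`, the sesquilinear form with
`⟨r ⊗ p, r' ⊗ p'⟩ = (τ_θ ⊗ id) {⟨r, r'⟩ p', p}`, where `τ_θ` is the trace of `A_θ`. -/
def tensorInner :
    BalTensor θ θ' R P →ₛₗ[starRingEnd ℂ] BalTensor θ θ' R P →ₗ[ℂ] SmoothTorus θ' :=
  (balancing θ θ' R P).liftQ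
    (TensorProduct.lift (LinearMap.mk₂'ₛₗ (starRingEnd ℂ) (starRingEnd ℂ) (innerSimple hR hP)
      (fun r₁ r₂ p => hom_ext fun r' p' => by
        rw [LinearMap.add_apply, innerSimple_tmul, innerSimple_tmul, innerSimple_tmul,
          hR.inner_add_left, map_add, add_smul, hP.inner_add_left, map_add])
      (fun c r p => hom_ext fun r' p' => by
        rw [LinearMap.smul_apply, innerSimple_tmul, innerSimple_tmul,
          hR.inner_csmul_left, map_smul, smul_assoc, hP.inner_csmul_left, map_smul])
      (fun r p₁ p₂ => hom_ext fun r' p' => by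
        rw [LinearMap.add_apply, innerSimple_tmul, innerSimple_tmul, innerSimple_tmul,
          hP.inner_add_right, map_add])
      (fun c r p => hom_ext fun r' p' => by
        rw [LinearMap.smul_apply, innerSimple_tmul, innerSimple_tmul,
          hP.inner_csmul_right, map_smul]))) <| by
    refine Submodule.span_le.2 ?_
    rintro _ ⟨r, a, p, rfl⟩
    rw [SetLike.mem_coe, LinearMap.mem_ker, map_sub, sub_eq_zero, TensorProduct.lift.tmul,
      TensorProduct.lift.tmul]
    refine hom_ext fun r' p' => ?_
    change innerSimple hR hP (op a • r) p _ = innerSimple hR hP r (embL θ θ' a • p) _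
    rw [innerSimple_tmul, innerSimple_tmul, hR.inner_smul_left, map_mul, mul_smul,
      hP.inner_smul_left, ptrace_comm, embL_star, hP.inner_smul_right]

theorem tensorInner_tmul (r r' : R) (p p' : P) :
    tensorInner hR hP (tmul θ θ' r p) (tmul θ θ' r' p')
      = ptrace θ θ' (hP.inner (embL θ θ' (hR.inner r r') • p') p) := rfl

/-- The norm of a vector of the Hermitian `A_θ'`-module `R ⊗_{A_θ} P`. -/
def tensorNorm (x : BalTensor θ θ' R P) : ℝ := Real.sqrt (cstarNorm (tensorInner hR hP x x))

variable {hR hP} (nR : Connection hR) (nP : LeftConnection hP)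

/-- The operator `∇^R_v + ∇_v` on `R ⊗_{A_θ} P`, that is `∇^R_v ⊗ 1 + 1 ⊗ ∇_v`, for `v` in the Lie
algebra of `A_θ`. -/
def tensorNabla (v : ι → ℝ) : BalTensor θ θ' R P →ₗ[ℂ] BalTensor θ θ' R P :=
  BalTensor.lift θ θ'
    ((mk θ θ').comp (nR.nabla v) + (mk θ θ').compl₂ (nP.nabla (Sum.elim v 0))) fun r a p => by
    change tmul θ θ' (nR.nabla v (op a • r)) p + tmul θ θ' (op a • r) (nP.nabla (Sum.elim v 0) p)
      = tmul θ θ' (nR.nabla v r) (embL θ θ' a • p)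
        + tmul θ θ' r (nP.nabla (Sum.elim v 0) (embL θ θ' a • p))
    rw [nR.leibniz, nP.leibniz, add_tmul, tmul_add, balance, balance, balance, deriv_embL]
    abel

theorem tensorNabla_tmul (v : ι → ℝ) (r : R) (p : P) :
    tensorNabla nR nP v (tmul θ θ' r p)
      = tmul θ θ' (nR.nabla v r) p + tmul θ θ' r (nP.nabla (Sum.elim v 0) p) := rfl

theorem deriv_zero (a : SmoothTorus θ) : deriv (0 : ι → ℝ) a = 0 := by
  ext n; simp [coeff_deriv]

/-- The operator `1 ⊗ ∇_w` on `R ⊗_{A_θ} P`, for `w` in the Lie algebra of `A_θ'`. -/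
def tensorNablaHat (w : κ → ℝ) : BalTensor θ θ' R P →ₗ[ℂ] BalTensor θ θ' R P :=
  BalTensor.lift θ θ' ((mk θ θ').compl₂ (nP.nabla (Sum.elim 0 w))) fun r a p => by
    change tmul θ θ' (op a • r) (nP.nabla (Sum.elim 0 w) p)
      = tmul θ θ' r (nP.nabla (Sum.elim 0 w) (embL θ θ' a • p))
    rw [nP.leibniz, deriv_embL, deriv_zero, map_zero, zero_smul, add_zero, balance]

theorem tensorNablaHat_tmul (w : κ → ℝ) (r : R) (p : P) :
    tensorNablaHat nP w (tmul θ θ' r p) = tmul θ θ' r (nP.nabla (Sum.elim 0 w) p) := rfl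

theorem tensorNabla_op_smul (v : ι → ℝ) (b : (SmoothTorus θ')ᵐᵒᵖ) (x : BalTensor θ θ' R P) :
    tensorNabla nR nP v (b • x) = b • tensorNabla nR nP v x := by
  have h : tensorNabla nR nP v ∘ₗ rightMul θ θ' b = rightMul θ θ' b ∘ₗ tensorNabla nR nP v :=
    hom_ext fun r p => by
      rw [LinearMap.comp_apply, LinearMap.comp_apply, rightMul_tmul, tensorNabla_tmul,
        tensorNabla_tmul, map_add, rightMul_tmul, rightMul_tmul, nP.leibniz, deriv_embR,
        deriv_zero, op_zero, map_zero, zero_smul, add_zero]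
  exact LinearMap.congr_fun h x

end structures

/-! ### Four dimensions: self-duality, spinors and the Dirac operator -/

section four

/-- The Lie algebra `L_θ` of a four-dimensional torus, with `v` standing for `δ_v`. -/
abbrev LieAlg : Type := Fin 4 → ℝ

/-- `b` is an orthonormal frame for the inner product with matrix `g`. -/
def IsOrthonormalFrame (g : Matrix (Fin 4) (Fin 4) ℝ) (b : Fin 4 → LieAlg) : Prop :=
  ∀ i j, b i ⬝ᵥ g.mulVec (b j) = if i = j then 1 else 0

/-- The value of the two-form with matrix `M` on a pair of vectors. -/
def twoForm {ι κ : Type} [Fintype ι] [Fintype κ] (M : Matrix ι κ ℂ) (v : ι → ℝ) (w : κ → ℝ) : ℂ :=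
  ∑ i, ∑ j, (v i : ℂ) * M i j * (w j : ℂ)

/-- The Levi-Civita symbol `ε_{ijkl}`. -/
def levi (i j k l : Fin 4) : ℤ :=
  Int.sign ((j : ℤ) - i) * Int.sign ((k : ℤ) - i) * Int.sign ((l : ℤ) - i) *
    Int.sign ((k : ℤ) - j) * Int.sign ((l : ℤ) - j) * Int.sign ((l : ℤ) - k)

/-- For the components `F_{ij} = F(b_i, b_j)` of a two-form in an oriented orthonormal frame, the
components `(⋆F)_{ij} = (1/2) ∑ ε_{ijkl} F_{kl}` of its Hodge dual. -/
def hodge {M : Type*} [AddCommGroup M] [Module ℂ M] (F : Fin 4 → Fin 4 → M) (i j : Fin 4) : M :=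
  (1 / 2 : ℂ) • ∑ k, ∑ l, (levi i j k l : ℂ) • F k l

/-- The components of the self-dual part `F⁺ = (F + ⋆F) / 2`. -/
def selfDualPart {M : Type*} [AddCommGroup M] [Module ℂ M] (F : Fin 4 → Fin 4 → M)
    (i j : Fin 4) : M :=
  (1 / 2 : ℂ) • (F i j + hodge F i j)

/-- The Gamma matrices `Γ^i : S⁺ → S⁻` for `S⁺ = S⁻ = ℂ²`: the identity and `i` times the three
Pauli matrices. -/
def gammaPlus : Fin 4 → Matrix (Fin 2) (Fin 2) ℂ :=
  ![!![1, 0; 0, 1], !![0, Complex.I; Complex.I, 0], !![0, 1; -1, 0],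
    !![Complex.I, 0; 0, -Complex.I]]

/-- The Gamma matrices `Γ^i : S⁻ → S⁺`, the adjoints of `Γ^i : S⁺ → S⁻`. -/
def gammaMinus (i : Fin 4) : Matrix (Fin 2) (Fin 2) ℂ := (gammaPlus i).conjTranspose

end four

section nahm

variable {θ θ' : SkewForm (Fin 4)}
variable {R P : Type*} [AddCommGroup R] [Module ℂ R] [Module (SmoothTorus θ)ᵐᵒᵖ R]
  [IsScalarTower ℂ (SmoothTorus θ)ᵐᵒᵖ R]
  [AddCommGroup P] [Module ℂ P] [Module (SmoothTorus (θ.diff θ')) P]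
  [IsScalarTower ℂ (SmoothTorus (θ.diff θ')) P]

variable (θ θ' R P) in
/-- `(R ⊗_{A_θ} P) ⊗ S^±`, where `S^± = ℂ²`. -/
abbrev Spinors : Type _ := Fin 2 → BalTensor θ θ' R P

variable {hR : HermitianForm θ R} {hP : LeftHermitianForm (θ.diff θ') P}

variable (hR hP) in
/-- The `A_θ'`-valued inner product on `(R ⊗_{A_θ} P) ⊗ S^±`. -/
def spinorInner (ψ φ : Spinors θ θ' R P) : SmoothTorus θ' := ∑ s, tensorInner hR hP (ψ s) (φ s)

variable (nR : Connection hR) (nP : LeftConnection hP)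

/-- The Laplacian `Δ = ∑ (∇^R_{α_i} + ∇_{α_i}) (∇^R_{α_i} + ∇_{α_i})`. -/
def laplacian (α : Fin 4 → LieAlg) : BalTensor θ θ' R P →ₗ[ℂ] BalTensor θ θ' R P :=
  ∑ i, tensorNabla nR nP (α i) ∘ₗ tensorNabla nR nP (α i)

/-- `∇^R` is `P`-irreducible: the Laplacian has an inverse, and this inverse is bounded. -/
def IsPIrreducible (α : Fin 4 → LieAlg) : Prop :=
  ∃ G : BalTensor θ θ' R P →ₗ[ℂ] BalTensor θ θ' R P,
    G ∘ₗ laplacian nR nP α = LinearMap.id ∧ laplacian nR nP α ∘ₗ G = LinearMap.id ∧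
    ∃ C : ℝ, ∀ x, tensorNorm hR hP (G x) ≤ C * tensorNorm hR hP x

/-- The operator `∑ Γ^i (∇^R_{α_i} + ∇_{α_i})` on `(R ⊗_{A_θ} P) ⊗ ℂ²`. For `Γ = gammaPlus` it is
`D⁺`, and for `Γ = gammaMinus` it is `D⁻`. -/
def dirac (Γ : Fin 4 → Matrix (Fin 2) (Fin 2) ℂ) (α : Fin 4 → LieAlg) :
    Spinors θ θ' R P →ₗ[ℂ] Spinors θ θ' R P :=
  LinearMap.pi fun s => ∑ i, ∑ t, Γ i s t • (tensorNabla nR nP (α i) ∘ₗ LinearMap.proj t)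

theorem dirac_op_smul (Γ : Fin 4 → Matrix (Fin 2) (Fin 2) ℂ) (α : Fin 4 → LieAlg)
    (b : (SmoothTorus θ')ᵐᵒᵖ) (ψ : Spinors θ θ' R P) :
    dirac nR nP Γ α (b • ψ) = b • dirac nR nP Γ α ψ := by
  funext s
  simp only [dirac, LinearMap.pi_apply, LinearMap.sum_apply, LinearMap.smul_apply,
    LinearMap.comp_apply, LinearMap.proj_apply, Pi.smul_apply, tensorNabla_op_smul,
    Finset.smul_sum]
  exact Finset.sum_congr rfl fun i _ => Finset.sum_congr rfl fun t _ => smul_comm _ _ _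

/-- The (smooth part of the) right `A_θ'`-module `ker D⁻ ⊆ (R ⊗_{A_θ} P) ⊗ S⁻` underlying the
Nahm transform. -/
def nahmModule (α : Fin 4 → LieAlg) : Submodule (SmoothTorus θ')ᵐᵒᵖ (Spinors θ θ' R P) where
  carrier := {ψ | dirac nR nP gammaMinus α ψ = 0}
  add_mem' {ψ φ} hψ hφ := by
    rw [Set.mem_ofPred_eq] at *
    rw [map_add, hψ, hφ, add_zero]
  zero_mem' := map_zero _
  smul_mem' b ψ hψ := by
    rw [Set.mem_ofPred_eq] at *
    rw [dirac_op_smul, hψ, smul_zero]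

variable (hR hP) in
/-- `Q` is the orthogonal projection, with respect to the `A_θ'`-valued inner product, of
`(R ⊗_{A_θ} P) ⊗ S⁻` onto the submodule `N`. -/
structure IsOrthogonalProjection (N : Submodule (SmoothTorus θ')ᵐᵒᵖ (Spinors θ θ' R P))
    (Q : Spinors θ θ' R P →ₗ[ℂ] Spinors θ θ' R P) : Prop where
  hermitian : ∀ ψ φ, spinorInner hR hP (Q ψ) φ = spinorInner hR hP ψ (Q φ)
  idempotent : ∀ ψ, Q (Q ψ) = Q ψ
  range_eq : ∀ ψ, (∃ φ, Q φ = ψ) ↔ ψ ∈ N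

/-- The connection `∇̂'` induced by `∇̂` on `(R ⊗_{A_θ} P) ⊗ S⁻`. -/
def spinorNablaHat (w : LieAlg) : Spinors θ θ' R P →ₗ[ℂ] Spinors θ θ' R P :=
  LinearMap.pi fun s => tensorNablaHat nP w ∘ₗ LinearMap.proj s

/-- `Ω` is the (constant) curvature of the connection `∇ ⊕ ∇̂` on `P`. -/
def HasConstantCurvature (Ω : Matrix (Fin 4 ⊕ Fin 4) (Fin 4 ⊕ Fin 4) ℂ) : Prop :=
  ∀ X Y : Fin 4 ⊕ Fin 4 → ℝ,
    opCommutator (nP.nabla X) (nP.nabla Y) = twoForm Ω X Y • LinearMap.id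

end nahm

section dual

/-- The real pairing `s` between the two Lie algebras, with `σ = i s`. Commutators of Hermitian
connections are skew, so `σ` is purely imaginary. -/
def realPairing (σ : Matrix (Fin 4) (Fin 4) ℂ) : Matrix (Fin 4) (Fin 4) ℝ := σ.map Complex.im

/-- The inner product on the Lie algebra of `A_θ'` obtained from the inner product `g` on the Lie
algebra `L_θ` of `A_θ` by the identification `w ↦ s(·, w)` of the former with the dual of `L_θ`,
which carries the inner product with matrix `g⁻¹`. -/
def dualInner (g : Matrix (Fin 4) (Fin 4) ℝ) (σ : Matrix (Fin 4) (Fin 4) ℂ) :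
    Matrix (Fin 4) (Fin 4) ℝ :=
  (realPairing σ).transpose * g⁻¹ * realPairing σ

/-- `b` is positively oriented for the orientation which the pairing induces from the one of `L_θ`
given by the frame `α`: the matrix `(s(α_i, b_j))` has positive determinant. It does not matter
whether `s` or `-s` is used, since the dimension is even. -/
def IsPositivelyOriented (σ : Matrix (Fin 4) (Fin 4) ℂ) (α b : Fin 4 → LieAlg) : Prop :=
  0 < (Matrix.of fun i j => α i ⬝ᵥ (realPairing σ).mulVec (b j)).det

end dual

end

end NCNahm

open NCNahm

/-! The argument is the algebraic core of the Nahm transform: a Weitzenböck formula, a Green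
operator, and one commutator.

Since `1 ⊗ ∇` adds `ω` to the curvature of `∇^R`, the operators `∇^R_α + ∇_α` have curvature `F +
ω`, whose self-dual part vanishes. In `D⁻D⁺` this curvature is contracted with the antisymmetrised
products of Gamma matrices on `S⁺`, which are self-dual, so the contraction is zero and `D⁻D⁺ = Δ ⊗
1` (`sum_gammaMinus_mul_gammaPlus`, `dirac_gammaMinus_gammaPlus`). As `δ_v` with `v ∈ L_θ` is
annihilated by the partial trace, the covariant derivatives are symmetric and `D⁺`, `D⁻` are
mutually adjoint. Hence, with `G = Δ⁻¹`, the operator `P = 1 - D⁺ G D⁻` is an orthogonal projection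
onto `ker D⁻` (`isOrthogonalProjection_nahmProjection`). Its uniqueness rests on definiteness of the
inner product, which follows from a finite frame of `R` and faithfulness of the trace
(`tensorInner_eq_sum`, `IsPositive.eq_zero_of_trace_re`).

For the curvature, write `σ(v)Γ^± = ∑ σ(α_i, v) Γ^i`. Constancy of `σ` gives `[D^±, ∇̂_v] =
σ(v)Γ^±`, of order zero (`dirac_spinorNablaHat`). Together with `P D⁺ = 0` this turns `P∇̂_v P∇̂_w
ψ`, for `ψ ∈ ker D⁻`, into `P∇̂_v∇̂_w ψ + P σ(v)Γ⁺ σ(w)Γ⁻ Gψ`. Antisymmetrising, the curvature is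
`ω̂` plus the image under a fixed linear map of the matrices `σ(v)Γ⁺ σ(w)Γ⁻ - σ(w)Γ⁺ σ(v)Γ⁻`. The
inner product and orientation of `L_θ̂` are transported by `σ/i`, so in oriented orthonormal frames
`σ/i` is a matrix in `SO(4)`; the Hodge star commutes with such rotations (`selfDualPart_rotate`),
and the extra term inherits the antiselfduality of the Gamma products on `S⁻`. Only `ω̂⁺` survives
(`selfDualPart_nahm_curvature`). -/

namespace NCNahm

noncomputable section

open scoped TensorProduct
open SmoothTorus MulOpposite

namespace SmoothTorus

/-! ### Positive elements and faithfulness of the trace -/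

section positivity

variable {ι : Type} [Fintype ι] {θ : SkewForm ι}

theorem trace_add (a b : SmoothTorus θ) : trace (a + b) = trace a + trace b := rfl

theorem trace_smul (c : ℂ) (a : SmoothTorus θ) : trace (c • a) = c * trace a := rfl

theorem trace_deriv (v : ι → ℝ) (a : SmoothTorus θ) : trace (deriv v a) = 0 := by
  simp [trace, coeff_deriv]

theorem star_smul_complex (c : ℂ) (a : SmoothTorus θ) :
    star (c • a) = starRingEnd ℂ c • star a := by
  ext n; simp

theorem isPositive_zero : IsPositive (0 : SmoothTorus θ) :=
  ⟨star_zero _, fun x => by simp [trace]⟩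

theorem IsPositive.add {a b : SmoothTorus θ} (ha : IsPositive a) (hb : IsPositive b) :
    IsPositive (a + b) :=
  ⟨by rw [star_add, ha.1, hb.1], fun x => by
    rw [mul_add, add_mul, trace_add, Complex.add_re]
    exact add_nonneg (ha.2 x) (hb.2 x)⟩

theorem isPositive_sum {J : Type*} (s : Finset J) {a : J → SmoothTorus θ}
    (h : ∀ j ∈ s, IsPositive (a j)) : IsPositive (∑ j ∈ s, a j) := by
  classical
  induction s using Finset.induction_on with
  | empty => exact isPositive_zero
  | insert j s hj ih =>
    rw [Finset.sum_insert hj]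
    exact (h j (Finset.mem_insert_self _ _)).add
      (ih fun k hk => h k (Finset.mem_insert_of_mem hk))

theorem IsPositive.trace_re_nonneg {a : SmoothTorus θ} (ha : IsPositive a) :
    0 ≤ (trace a).re := by
  simpa using ha.2 1

/-- The cocycle is trivial on `(k, -k)`, so the trace is `∑ |a_n|²`. -/
theorem eq_zero_of_trace_star_mul_self {a : SmoothTorus θ} (h : (trace (star a * a)).re = 0) :
    a = 0 := by
  have hterm : ∀ k : ι → ℤ, (star a).coeff k * a.coeff (0 - k) * θ.phase k (0 - k)
      = ((‖a.coeff (-k)‖ ^ 2 : ℝ) : ℂ) := fun k => by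
    have hp : θ.phase k (0 - k) = 1 := by
      rw [zero_sub, SkewForm.phase, θ.form_neg_right, θ.form_self]; simp
    rw [hp, mul_one, zero_sub, coeff_star, Complex.conj_mul']
    push_cast; rfl
  have hs := summable_term (star a) a 0
  simp only [hterm] at hs
  rw [trace, coeff_mul, tsum_congr hterm, ← Complex.ofReal_tsum, Complex.ofReal_re] at h
  have hs' : Summable fun k => ‖a.coeff (-k)‖ ^ 2 := Complex.summable_ofReal.1 hs
  have h0 := (hasSum_zero_iff_of_nonneg (fun k => by positivity)).1 (h ▸ hs'.hasSum)
  ext n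
  simpa using congrFun h0 (-n)

/-- Testing positivity on `1 + t a` gives `t² τ(a³) + 2t τ(a²) ≥ 0` for all real `t`, the constant
term being `τ(a) = 0`. The discriminant then forces `τ(a²) = 0`, and `a² = a^* a`. -/
theorem IsPositive.eq_zero_of_trace_re {a : SmoothTorus θ} (ha : IsPositive a)
    (h : (trace a).re = 0) : a = 0 := by
  refine eq_zero_of_trace_star_mul_self ?_
  have key : ∀ t : ℝ, 0 ≤ (trace (star a * a * a)).re * (t * t)
      + (2 * (trace (star a * a)).re) * t + 0 := fun t => by
    have h1 := ha.2 (1 + (t : ℂ) • a)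
    have h2 : star (1 + (t : ℂ) • a) * a * (1 + (t : ℂ) • a)
        = a + (t : ℂ) • (star a * a) + ((t : ℂ) • (star a * a)
          + (t : ℂ) • (t : ℂ) • (star a * a * a)) := by
      rw [star_add, star_one, star_smul_complex, Complex.conj_ofReal, ha.1]
      simp only [add_mul, mul_add, one_mul, mul_one, smul_mul_assoc, mul_smul_comm, smul_add]
    rw [h2] at h1
    simp only [trace_add, trace_smul, Complex.add_re, h, Complex.re_ofReal_mul] at h1
    linarith
  have := discrim_le_zero key
  rw [discrim] at this
  nlinarith [sq_nonneg (trace (star a * a)).re]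

end positivity

/-! ### The partial trace as a positive bimodule map -/

section partialTrace

variable {ι κ : Type} [Fintype ι] [Fintype κ] {θ : SkewForm ι} {θ' : SkewForm κ}

theorem trace_ptrace (a : SmoothTorus (θ.diff θ')) : trace (ptrace θ θ' a) = trace a := by
  rw [trace, coeff_ptrace, map_zero, trace]

theorem ptrace_star (a : SmoothTorus (θ.diff θ')) :
    ptrace θ θ' (star a) = star (ptrace θ θ' a) := by
  ext n
  rw [coeff_ptrace, coeff_star, coeff_star, coeff_ptrace, map_neg]

theorem ptrace_deriv (w : κ → ℝ) (a : SmoothTorus (θ.diff θ')) :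
    ptrace θ θ' (deriv (Sum.elim 0 w) a) = deriv w (ptrace θ θ' a) := by
  ext n
  rw [coeff_ptrace, coeff_deriv, coeff_deriv, coeff_ptrace]
  simp [inrHom, Fintype.sum_sum_type]

theorem ptrace_deriv_left (v : ι → ℝ) (a : SmoothTorus (θ.diff θ')) :
    ptrace θ θ' (deriv (Sum.elim v 0) a) = 0 := by
  ext n
  rw [coeff_ptrace, coeff_deriv]
  simp [inrHom, Fintype.sum_sum_type]

/-- The order is reversed because `embR` embeds the opposite algebra: left multiplication upstairs
becomes right multiplication in `A_θ'`. -/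
theorem ptrace_embR_mul (b : (SmoothTorus θ')ᵐᵒᵖ) (a : SmoothTorus (θ.diff θ')) :
    ptrace θ θ' (embR θ θ' b * a) = ptrace θ θ' a * b.unop := by
  ext n
  rw [coeff_ptrace, embR_apply, coeff_push_mul, coeff_mul, ← (Equiv.subLeft n).tsum_eq]
  refine tsum_congr fun k => ?_
  simp only [Equiv.subLeft_apply]
  rw [← map_sub, phase_inr, coeff_ptrace, sub_sub_cancel, mul_comm (b.unop.coeff _)]

theorem ptrace_mul_embR (b : (SmoothTorus θ')ᵐᵒᵖ) (a : SmoothTorus (θ.diff θ')) :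
    ptrace θ θ' (a * embR θ θ' b) = b.unop * ptrace θ θ' a := by
  ext n
  rw [coeff_ptrace, embR_apply, coeff_mul_push, coeff_mul]
  refine tsum_congr fun k => ?_
  rw [← map_sub, phase_inr, coeff_ptrace, mul_comm (b.unop.coeff _)]

theorem embR_star (b : SmoothTorus θ') : embR θ θ' (op (star b)) = star (embR θ θ' (op b)) :=
  push_star (hφ := norm_inrHom) b

/-- A test element `x` of `A_θ'` is lifted to `embR (op (star x))`; the bimodule property turns
positivity of `a` on the lift into `τ(x^* (ptrace a) x) ≥ 0`. -/
theorem IsPositive.ptrace {a : SmoothTorus (θ.diff θ')} (ha : IsPositive a) :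
    IsPositive (ptrace θ θ' a) := by
  refine ⟨by rw [← ptrace_star, ha.1], fun x => ?_⟩
  have h := ha.2 (embR θ θ' (op (star x)))
  rw [← embR_star, star_star, mul_assoc, ← trace_ptrace, ptrace_embR_mul, ptrace_mul_embR] at h
  exact h

end partialTrace

end SmoothTorus

/-! ### Inner product and covariant derivatives on `R ⊗_{A_θ} P` -/

namespace BalTensor

variable {ι κ : Type} [Fintype ι] [Fintype κ] {θ : SkewForm ι} {θ' : SkewForm κ}
variable {R P : Type*} [AddCommGroup R] [Module ℂ R] [Module (SmoothTorus θ)ᵐᵒᵖ R]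
  [AddCommGroup P] [Module ℂ P] [Module (SmoothTorus (θ.diff θ')) P]

theorem induction_on {motive : BalTensor θ θ' R P → Prop} (x : BalTensor θ θ' R P)
    (zero : motive 0) (tmul : ∀ r p, motive (tmul θ θ' r p))
    (add : ∀ x y, motive x → motive y → motive (x + y)) : motive x := by
  obtain ⟨t, rfl⟩ := Submodule.Quotient.mk_surjective _ x
  induction t using TensorProduct.induction_on with
  | zero => exact zero
  | tmul r p => exact tmul r p
  | add s t hs ht => exact add _ _ hs ht

theorem smul_tmul (c : ℂ) (r : R) (p : P) :
    BalTensor.tmul θ θ' (c • r) p = c • BalTensor.tmul θ θ' r p :=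
  LinearMap.map_smul₂ (mk θ θ') c r p

theorem sub_tmul (r s : R) (p : P) :
    BalTensor.tmul θ θ' (r - s) p = BalTensor.tmul θ θ' r p - BalTensor.tmul θ θ' s p :=
  LinearMap.map_sub₂ (mk θ θ') r s p

theorem tmul_sub (r : R) (p q : P) :
    BalTensor.tmul θ θ' r (p - q) = BalTensor.tmul θ θ' r p - BalTensor.tmul θ θ' r q :=
  map_sub (mk θ θ' r) p q

theorem sum_tmul {J : Type*} (s : Finset J) (r : J → R) (p : P) :
    BalTensor.tmul θ θ' (∑ j ∈ s, r j) p = ∑ j ∈ s, BalTensor.tmul θ θ' (r j) p :=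
  LinearMap.map_sum₂ (mk θ θ') s r p

end BalTensor

section innerProduct

open BalTensor

variable {ι κ : Type} [Fintype ι] [Fintype κ] {θ : SkewForm ι} {θ' : SkewForm κ}
variable {R P : Type*} [AddCommGroup R] [Module ℂ R] [Module (SmoothTorus θ)ᵐᵒᵖ R]
  [AddCommGroup P] [Module ℂ P] [Module (SmoothTorus (θ.diff θ')) P]
  [IsScalarTower ℂ (SmoothTorus θ)ᵐᵒᵖ R] [IsScalarTower ℂ (SmoothTorus (θ.diff θ')) P]

section frame

variable (hR : HermitianForm θ R) (hP : LeftHermitianForm (θ.diff θ') P)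

theorem HermitianForm.inner_sum_right {J : Type*} (s : Finset J) (x : R) (y : J → R) :
    hR.inner x (∑ j ∈ s, y j) = ∑ j ∈ s, hR.inner x (y j) :=
  map_sum (AddMonoidHom.mk' (hR.inner x) (hR.inner_add_right x)) y s

theorem LeftHermitianForm.inner_sum_left {J : Type*} (s : Finset J) (x : J → P) (y : P) :
    hP.inner (∑ j ∈ s, x j) y = ∑ j ∈ s, hP.inner (x j) y :=
  map_sum (AddMonoidHom.mk' (fun x => hP.inner x y) fun a b => hP.inner_add_left a b y) x s

/-- The coordinate `r ⊗ p ↦ ⟨u, r⟩ p` of `R ⊗_{A_θ} P` given by a vector `u` of `R`. -/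
def tensorCoord (u : R) : BalTensor θ θ' R P →ₗ[ℂ] P :=
  BalTensor.lift θ θ'
    (LinearMap.mk₂ ℂ (fun r p => embL θ θ' (hR.inner u r) • p)
      (fun r₁ r₂ p => by rw [hR.inner_add_right, map_add, add_smul])
      (fun c r p => by rw [hR.inner_csmul_right, map_smul, smul_assoc])
      (fun r p₁ p₂ => smul_add _ _ _)
      (fun c r p => smul_comm _ _ _))
    fun r a p => by
      rw [LinearMap.mk₂_apply, LinearMap.mk₂_apply, hR.inner_smul_right, map_mul, mul_smul]

theorem tensorCoord_tmul (u r : R) (p : P) :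
    tensorCoord hR u (tmul θ θ' r p) = embL θ θ' (hR.inner u r) • p := rfl

variable {hR} {n : ℕ} {u : Fin n → R}

theorem eq_sum_tmul_tensorCoord (hu : ∀ y, y = ∑ i, op (hR.inner (u i) y) • u i)
    (x : BalTensor θ θ' R P) : x = ∑ i, tmul θ θ' (u i) (tensorCoord hR (u i) x) := by
  induction x using BalTensor.induction_on with
  | zero => simp only [map_zero, tmul_zero, Finset.sum_const_zero]
  | tmul r p =>
    conv_lhs => rw [hu r, sum_tmul]
    exact Finset.sum_congr rfl fun i _ => balance _ _ _ _ _
  | add x y hx hy =>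
    simp only [map_add, tmul_add, Finset.sum_add_distrib]
    rw [← hx, ← hy]

/-- A frame embeds `R ⊗_{A_θ} P` isometrically into a finite power of `P` with its partially traced
inner product. Positivity and definiteness of `tensorInner`, invisible on sums of simple tensors,
are read off from here. -/
theorem tensorInner_eq_sum (hu : ∀ y, y = ∑ i, op (hR.inner (u i) y) • u i)
    (x y : BalTensor θ θ' R P) : tensorInner hR hP x y
      = ∑ i, ptrace θ θ' (hP.inner (tensorCoord hR (u i) y) (tensorCoord hR (u i) x)) := by
  induction x using BalTensor.induction_on with
  | zero =>
    have h0 : ∀ p : P, hP.inner p 0 = 0 := fun p => by simpa using hP.inner_smul_right 0 p p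
    simp [h0]
  | add x x' hx hx' =>
    rw [map_add, LinearMap.add_apply, hx, hx', ← Finset.sum_add_distrib]
    exact Finset.sum_congr rfl fun i _ => by rw [map_add, hP.inner_add_right, map_add]
  | tmul r p =>
    induction y using BalTensor.induction_on with
    | zero =>
      have h0 : ∀ p : P, hP.inner 0 p = 0 := fun p => by simpa using hP.inner_smul_left 0 p p
      simp [h0]
    | add y y' hy hy' =>
      rw [map_add, hy, hy', ← Finset.sum_add_distrib]
      exact Finset.sum_congr rfl fun i _ => by rw [map_add, hP.inner_add_left, map_add]
    | tmul r' p' =>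
      rw [tensorInner_tmul]
      -- Only `r'` is expanded, so `⟨r, r'⟩ = ∑ ⟨r, u_i⟩⟨u_i, r'⟩`. The factor `⟨r, u_i⟩ = ⟨u_i,
      -- r⟩^*` is then carried into the second slot by the trace property over `A_θ`.
      conv_lhs => rw [hu r', hR.inner_sum_right, map_sum, Finset.sum_smul, hP.inner_sum_left,
        map_sum]
      refine Finset.sum_congr rfl fun i _ => ?_
      rw [tensorCoord_tmul, tensorCoord_tmul, hR.inner_smul_right, ← hR.star_inner, map_mul,
        mul_smul, hP.inner_smul_left, ptrace_comm, hP.inner_smul_right, embL_star]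

theorem isPositive_tensorInner (hR : HermitianForm θ R) (hRproj : hR.IsProjective)
    (x : BalTensor θ θ' R P) : IsPositive (tensorInner hR hP x x) := by
  obtain ⟨n, u, hu⟩ := hRproj
  rw [tensorInner_eq_sum hP hu]
  exact isPositive_sum _ fun i _ => (hP.inner_pos _).ptrace

/-- In frame coordinates the trace is a sum of non-negative terms, so each vanishes, and
faithfulness of the trace with definiteness on `P` kills every coordinate. -/
theorem eq_zero_of_trace_tensorInner (hR : HermitianForm θ R) (hRproj : hR.IsProjective)
    {x : BalTensor θ θ' R P} (h : (trace (tensorInner hR hP x x)).re = 0) : x = 0 := by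
  obtain ⟨n, u, hu⟩ := hRproj
  have hsum : (trace (tensorInner hR hP x x)).re
      = ∑ i, (trace (hP.inner (tensorCoord hR (u i) x) (tensorCoord hR (u i) x))).re := by
    rw [tensorInner_eq_sum hP hu]
    simp only [← trace_ptrace (θ := θ) (θ' := θ')]
    exact map_sum (AddMonoidHom.mk' (fun a : SmoothTorus θ' => (trace a).re) fun a b => rfl) _ _
  rw [hsum, Finset.sum_eq_zero_iff_of_nonneg fun i _ => (hP.inner_pos _).trace_re_nonneg] at h
  rw [eq_sum_tmul_tensorCoord hu x]
  refine Finset.sum_eq_zero fun i hi => ?_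
  rw [hP.definite _ ((hP.inner_pos _).eq_zero_of_trace_re (h i hi)), tmul_zero]

end frame

variable (hR : HermitianForm θ R) (hP : LeftHermitianForm (θ.diff θ') P)

theorem star_tensorInner (x y : BalTensor θ θ' R P) :
    star (tensorInner hR hP x y) = tensorInner hR hP y x := by
  induction x using BalTensor.induction_on with
  | zero => simp
  | add x x' hx hx' => rw [map_add, map_add, LinearMap.add_apply, star_add, hx, hx']
  | tmul r p =>
    induction y using BalTensor.induction_on with
    | zero => simp
    | add y y' hy hy' => rw [map_add, map_add, LinearMap.add_apply, star_add, hy, hy']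
    | tmul r' p' =>
      rw [tensorInner_tmul, tensorInner_tmul, ← ptrace_star, hP.star_inner, ← hR.star_inner r r',
        embL_star, hP.inner_smul_left, hP.inner_smul_right, ← embL_star, ptrace_comm]

theorem tensorInner_op_smul_right (x y : BalTensor θ θ' R P) (b : (SmoothTorus θ')ᵐᵒᵖ) :
    tensorInner hR hP x (b • y) = tensorInner hR hP x y * b.unop := by
  induction x using BalTensor.induction_on with
  | zero => simp
  | add x x' hx hx' => rw [map_add, LinearMap.add_apply, LinearMap.add_apply, hx, hx', add_mul]
  | tmul r p =>
    induction y using BalTensor.induction_on with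
    | zero => simp
    | add y y' hy hy' => rw [smul_add, map_add, map_add, hy, hy', add_mul]
    | tmul r' p' =>
      rw [op_smul_tmul, tensorInner_tmul, tensorInner_tmul, smul_smul, embL_comm_embR, mul_smul,
        hP.inner_smul_left, ptrace_embR_mul]

variable {hR hP} (nR : Connection hR) (nP : LeftConnection hP)

/-- Compatibility would leave the term `δ_v` of the inner product on `P`, but `τ_θ ⊗ id` annihilates
derivatives along `L_θ`; the derivative of `⟨r, r'⟩` is absorbed by compatibility of `∇^R`. -/
theorem tensorInner_tensorNabla (v : ι → ℝ) (x y : BalTensor θ θ' R P) :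
    tensorInner hR hP (tensorNabla nR nP v x) y = tensorInner hR hP x (tensorNabla nR nP v y) := by
  induction x using BalTensor.induction_on with
  | zero => simp
  | add x x' hx hx' => simp only [map_add, LinearMap.add_apply, hx, hx']
  | tmul r p =>
    induction y using BalTensor.induction_on with
    | zero => simp
    | add y y' hy hy' => simp only [map_add, hy, hy']
    | tmul r' p' =>
      have h := nP.compatible (Sum.elim v 0) (embL θ θ' (hR.inner r r') • p') p
      rw [nP.leibniz, deriv_embL, nR.compatible, hP.inner_add_left, map_sub, sub_smul] at h
      have h' := congrArg (ptrace θ θ') h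
      rw [ptrace_deriv_left, sub_eq_add_neg (_ • p'), hP.inner_add_left, ← neg_smul,
        hP.inner_smul_left (-_), neg_mul, ← hP.inner_smul_left] at h'
      simp only [map_add, map_sub, map_neg] at h'
      simp only [tensorNabla_tmul, map_add, LinearMap.add_apply, tensorInner_tmul]
      rw [eq_comm, ← sub_eq_zero, h']
      abel

/-- Derivatives along `L_θ'` do not act on `⟨r, r'⟩` and commute with the partial trace, so the
compatibility on `P` descends. -/
theorem deriv_tensorInner (w : κ → ℝ) (x y : BalTensor θ θ' R P) :
    deriv w (tensorInner hR hP x y) = tensorInner hR hP x (tensorNablaHat nP w y)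
      - tensorInner hR hP (tensorNablaHat nP w x) y := by
  induction x using BalTensor.induction_on with
  | zero => simp
  | add x x' hx hx' => simp only [map_add, LinearMap.add_apply, hx, hx']; abel
  | tmul r p =>
    induction y using BalTensor.induction_on with
    | zero => simp
    | add y y' hy hy' => simp only [map_add, hy, hy']; abel
    | tmul r' p' =>
      have h := nP.compatible (Sum.elim 0 w) (embL θ θ' (hR.inner r r') • p') p
      rw [nP.leibniz, deriv_embL, deriv_zero, map_zero, zero_smul, add_zero] at h
      simp only [tensorNablaHat_tmul, tensorInner_tmul]
      rw [← ptrace_deriv, h, map_sub]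

theorem tensorNablaHat_op_smul (w : κ → ℝ) (b : SmoothTorus θ') (x : BalTensor θ θ' R P) :
    tensorNablaHat nP w (op b • x)
      = op b • tensorNablaHat nP w x + op (deriv w b) • x := by
  induction x using BalTensor.induction_on with
  | zero => simp
  | add x x' hx hx' => simp only [smul_add, map_add, hx, hx']; abel
  | tmul r p =>
    rw [op_smul_tmul, tensorNablaHat_tmul, tensorNablaHat_tmul, nP.leibniz, deriv_embR, tmul_add,
      op_smul_tmul, op_smul_tmul, unop_op]

/-- The cross terms `∇^R_v ⊗ ∇_w` and `∇^R_w ⊗ ∇_v` cancel in the commutator, so curvatures add. -/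
theorem opCommutator_tensorNabla_tmul (v w : ι → ℝ) (r : R) (p : P) :
    opCommutator (tensorNabla nR nP v) (tensorNabla nR nP w) (tmul θ θ' r p)
      = tmul θ θ' (opCommutator (nR.nabla v) (nR.nabla w) r) p
        + tmul θ θ' r (opCommutator (nP.nabla (Sum.elim v 0)) (nP.nabla (Sum.elim w 0)) p) := by
  simp only [opCommutator, LinearMap.sub_apply, LinearMap.comp_apply, tensorNabla_tmul, map_add,
    tmul_sub, sub_tmul]
  abel

theorem opCommutator_tensorNabla_tensorNablaHat_tmul (v : ι → ℝ) (w : κ → ℝ) (r : R) (p : P) :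
    opCommutator (tensorNabla nR nP v) (tensorNablaHat nP w) (tmul θ θ' r p)
      = tmul θ θ' r (opCommutator (nP.nabla (Sum.elim v 0)) (nP.nabla (Sum.elim 0 w)) p) := by
  simp only [opCommutator, LinearMap.sub_apply, LinearMap.comp_apply, tensorNabla_tmul,
    tensorNablaHat_tmul, map_add, tmul_sub]
  abel

theorem opCommutator_tensorNablaHat_tmul (v w : κ → ℝ) (r : R) (p : P) :
    opCommutator (tensorNablaHat nP v) (tensorNablaHat nP w) (tmul θ θ' r p)
      = tmul θ θ' r (opCommutator (nP.nabla (Sum.elim 0 v)) (nP.nabla (Sum.elim 0 w)) p) := by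
  simp only [opCommutator, LinearMap.sub_apply, LinearMap.comp_apply,
    tensorNablaHat_tmul, tmul_sub]

end innerProduct

end

end NCNahm

namespace NCNahm

noncomputable section

/-! ### The Hodge star, rotations and Gamma matrices -/

section hodgeStar

variable {M N : Type*} [AddCommGroup M] [Module ℂ M] [AddCommGroup N] [Module ℂ N]

theorem map_selfDualPart (f : M →ₗ[ℂ] N) (F : Fin 4 → Fin 4 → M) (i j : Fin 4) :
    f (selfDualPart F i j) = selfDualPart (fun k l => f (F k l)) i j := by
  simp only [selfDualPart, hodge, map_smul, map_add, map_sum]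

theorem selfDualPart_linearMap_apply (F : Fin 4 → Fin 4 → M →ₗ[ℂ] N) (x : M) (i j : Fin 4) :
    selfDualPart F i j x = selfDualPart (fun k l => F k l x) i j := by
  simp only [selfDualPart, hodge, LinearMap.smul_apply, LinearMap.add_apply, LinearMap.sum_apply]

theorem selfDualPart_add (F G : Fin 4 → Fin 4 → M) (i j : Fin 4) :
    selfDualPart (fun k l => F k l + G k l) i j = selfDualPart F i j + selfDualPart G i j := by
  simp only [selfDualPart, hodge, smul_add, Finset.sum_add_distrib]
  abel

theorem selfDualPart_smul (c : Fin 4 → Fin 4 → ℂ) (x : M) (i j : Fin 4) :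
    selfDualPart (fun k l => c k l • x) i j = selfDualPart c i j • x :=
  (map_selfDualPart (LinearMap.toSpanSingleton ℂ M x) c i j).symm

theorem selfDualPart_sub_smul_id_eq_zero (F : Fin 4 → Fin 4 → M →ₗ[ℂ] M) (c : Fin 4 → Fin 4 → ℂ)
    {i j : Fin 4} (h : ∀ x, selfDualPart (fun k l => F k l x) i j = selfDualPart c i j • x) :
    selfDualPart F i j - selfDualPart c i j • LinearMap.id = 0 := by
  ext x
  rw [LinearMap.sub_apply, selfDualPart_linearMap_apply, h, LinearMap.smul_apply,
    LinearMap.id_apply, sub_self, LinearMap.zero_apply]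

/-- Bridges the sign formula for `levi` and determinants by checking all 256 index quadruples;
multiplicativity of the determinant then becomes available for `ε`. -/
theorem levi_eq_det (f : Fin 4 → Fin 4) :
    levi (f 0) (f 1) (f 2) (f 3) = ((1 : Matrix (Fin 4) (Fin 4) ℤ).submatrix id f).det := by
  have h : ∀ a b c d : Fin 4,
      levi a b c d = ((1 : Matrix (Fin 4) (Fin 4) ℤ).submatrix id ![a, b, c, d]).det := by
    decide +kernel
  convert h (f 0) (f 1) (f 2) (f 3) using 3
  ext i; fin_cases i <;> rfl

theorem sum_levi_eq_det (A : Matrix (Fin 4) (Fin 4) ℂ) :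
    ∑ i, ∑ j, ∑ k, ∑ l, (levi i j k l : ℂ) * A i 0 * A j 1 * A k 2 * A l 3 = A.det := by
  have h2 : Int.sign 2 = 1 := rfl
  have h3 : Int.sign 3 = 1 := rfl
  rw [Matrix.det_succ_row_zero]
  simp [Fin.sum_univ_succ, Matrix.det_fin_three, levi, Fin.succAbove, h2, h3]
  ring

/-- Selecting columns of `A` is right multiplication by a selection of columns of the identity, so
the determinant factors. -/
theorem sum_levi_submatrix (A : Matrix (Fin 4) (Fin 4) ℂ) (a b c d : Fin 4) :
    ∑ i, ∑ j, ∑ k, ∑ l, (levi i j k l : ℂ) * A i a * A j b * A k c * A l d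
      = A.det * levi a b c d := by
  have h' : A.submatrix id ![a, b, c, d]
      = A * (1 : Matrix (Fin 4) (Fin 4) ℂ).submatrix id ![a, b, c, d] := by
    ext i j; simp [Matrix.mul_apply, Matrix.one_apply]
  have h1 : ((1 : Matrix (Fin 4) (Fin 4) ℂ).submatrix id ![a, b, c, d]).det = levi a b c d := by
    have := levi_eq_det ![a, b, c, d]
    have h2 : levi a b c d = ((1 : Matrix (Fin 4) (Fin 4) ℤ).submatrix id ![a, b, c, d]).det := this
    rw [h2, Int.cast_det]
    congr 1
    ext i j; simp [Matrix.one_apply]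
  rw [← h1, ← Matrix.det_mul, ← h', ← sum_levi_eq_det]
  rfl

/-- Invariance of `ε` under `SO(4)`, with two of the four factors `A` moved to the other side by
orthogonality. This is the form needed to pull a rotation through the Hodge star. -/
theorem sum_levi_orthogonal {A : Matrix (Fin 4) (Fin 4) ℂ} (hA : A * A.transpose = 1)
    (hdet : A.det = 1) (a b k l : Fin 4) :
    ∑ c, ∑ d, (levi a b c d : ℂ) * A k c * A l d
      = ∑ i, ∑ j, (levi i j k l : ℂ) * A i a * A j b := by
  have hsum : ∀ m n, ∑ c, A m c * A n c = if m = n then 1 else 0 := fun m n => by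
    rw [← Matrix.one_apply, ← hA]; rfl
  calc ∑ c, ∑ d, (levi a b c d : ℂ) * A k c * A l d
      = ∑ c, ∑ d, ∑ i, ∑ j, ∑ m, ∑ n,
          (levi i j m n : ℂ) * A i a * A j b * ((A m c * A k c) * (A n d * A l d)) := by
        refine Finset.sum_congr rfl fun c _ => Finset.sum_congr rfl fun d _ => ?_
        have h := sum_levi_submatrix A a b c d
        rw [hdet, one_mul] at h
        rw [← h]
        simp only [Finset.sum_mul]
        refine Finset.sum_congr rfl fun i _ => Finset.sum_congr rfl fun j _ =>
          Finset.sum_congr rfl fun m _ => Finset.sum_congr rfl fun n _ => ?_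
        ring
    _ = ∑ i, ∑ j, ∑ m, ∑ n, (levi i j m n : ℂ) * A i a * A j b
          * ((∑ c, A m c * A k c) * (∑ d, A n d * A l d)) := by
        -- Each use brings the third sum to the front, so the sums over `i, j, m, n` pass those over
        -- `c, d` one at a time.
        rw [Finset.sum_comm_cycle]; refine Finset.sum_congr rfl fun i _ => ?_
        rw [Finset.sum_comm_cycle]; refine Finset.sum_congr rfl fun j _ => ?_
        rw [Finset.sum_comm_cycle]; refine Finset.sum_congr rfl fun m _ => ?_
        rw [Finset.sum_comm_cycle]; refine Finset.sum_congr rfl fun n _ => ?_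
        rw [Finset.sum_mul_sum, Finset.mul_sum]
        simp only [Finset.mul_sum]
    _ = _ := by
        refine Finset.sum_congr rfl fun i _ => Finset.sum_congr rfl fun j _ => ?_
        simp [hsum]

theorem hodge_rotate {A : Matrix (Fin 4) (Fin 4) ℂ} (hA : A * A.transpose = 1)
    (hdet : A.det = 1) (F : Fin 4 → Fin 4 → ℂ) (a b : Fin 4) :
    hodge (fun c d => ∑ k, ∑ l, A k c * A l d * F k l) a b
      = ∑ i, ∑ j, A i a * A j b * hodge F i j := by
  simp only [hodge, smul_eq_mul, Finset.mul_sum]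
  calc _ = ∑ k, ∑ l, (∑ c, ∑ d, (levi a b c d : ℂ) * A k c * A l d) * (1 / 2 * F k l) := by
        simp only [Finset.sum_mul]
        rw [Finset.sum_comm_cycle]; refine Finset.sum_congr rfl fun k _ => ?_
        rw [Finset.sum_comm_cycle]; refine Finset.sum_congr rfl fun l _ => ?_
        refine Finset.sum_congr rfl fun _ _ => Finset.sum_congr rfl fun _ _ => ?_
        ring
    _ = _ := by
        simp only [sum_levi_orthogonal hA hdet, Finset.sum_mul]
        rw [Finset.sum_comm_cycle]; refine Finset.sum_congr rfl fun i _ => ?_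
        rw [Finset.sum_comm_cycle]; refine Finset.sum_congr rfl fun j _ => ?_
        refine Finset.sum_congr rfl fun _ _ => Finset.sum_congr rfl fun _ _ => ?_
        ring

theorem selfDualPart_rotate {A : Matrix (Fin 4) (Fin 4) ℂ} (hA : A * A.transpose = 1)
    (hdet : A.det = 1) (F : Fin 4 → Fin 4 → ℂ) (a b : Fin 4) :
    selfDualPart (fun c d => ∑ k, ∑ l, A k c * A l d * F k l) a b
      = ∑ i, ∑ j, A i a * A j b * selfDualPart F i j := by
  rw [selfDualPart, hodge_rotate hA hdet, ← Finset.sum_add_distrib, Finset.smul_sum]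
  refine Finset.sum_congr rfl fun i _ => ?_
  rw [← Finset.sum_add_distrib, Finset.smul_sum]
  refine Finset.sum_congr rfl fun j _ => ?_
  simp only [selfDualPart, smul_eq_mul]
  ring

theorem hodge_apply_of_skew (F : Fin 4 → Fin 4 → M) (hF : ∀ i j, F j i = -F i j) :
    hodge F 0 1 = F 2 3 ∧ hodge F 0 2 = F 3 1 ∧ hodge F 0 3 = F 1 2 := by
  have h2 : Int.sign 2 = 1 := rfl
  have h3 : Int.sign 3 = 1 := rfl
  refine ⟨?_, ?_, ?_⟩
  · simp [hodge, Fin.sum_univ_succ, levi, h2, h3]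
    rw [hF 2 3]
    module
  · simp [hodge, Fin.sum_univ_succ, levi, h2, h3]
    rw [hF 1 3]
    module
  · simp [hodge, Fin.sum_univ_succ, levi, h2, h3]
    rw [hF 1 2]
    module

/-- The self-dual two-forms are three-dimensional, and these three sums are their coordinates up to
scale. -/
theorem selfDualPart_eq_zero_of_skew (F : Fin 4 → Fin 4 → M) (hF : ∀ i j, F j i = -F i j)
    (h1 : F 0 1 + F 2 3 = 0) (h2 : F 0 2 + F 3 1 = 0) (h3 : F 0 3 + F 1 2 = 0) (i j : Fin 4) :
    selfDualPart F i j = 0 := by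
  have e2 : Int.sign 2 = 1 := rfl
  have e3 : Int.sign 3 = 1 := rfl
  -- Skewness gives only `2 F_ii = 0`; division by two uses the complex structure.
  have hz : ∀ i, F i i = 0 := fun i => by
    have h : (2 : ℂ) • F i i = 0 := by rw [two_smul]; nth_rewrite 1 [hF i i]; exact neg_add_cancel _
    exact (smul_eq_zero_iff_right two_ne_zero).1 h
  have h01 : F 0 1 = -F 2 3 := eq_neg_of_add_eq_zero_left h1
  have h02 : F 0 2 = F 1 3 := by rw [eq_neg_of_add_eq_zero_left h2, ← hF]
  have h03 : F 0 3 = -F 1 2 := eq_neg_of_add_eq_zero_left h3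
  have h10 := hF 0 1
  have h20 := hF 0 2
  have h30 := hF 0 3
  have h21 := hF 1 2
  have h31 := hF 1 3
  have h32 := hF 2 3
  rw [h01] at h10
  rw [h02] at h20
  rw [h03] at h30
  fin_cases i <;> fin_cases j <;>
    simp [selfDualPart, hodge, Fin.sum_univ_succ, levi, e2, e3, h01, h02, h03, h10, h20, h30, h21,
      h31, h32, hz] <;> module

theorem selfDualPart_gammaPlus_mul_gammaMinus (s t : Fin 2) (i j : Fin 4) :
    selfDualPart (fun k l => (gammaPlus k * gammaMinus l) s t
      - (gammaPlus l * gammaMinus k) s t) i j = 0 := by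
  refine selfDualPart_eq_zero_of_skew _ (fun i j => (neg_sub _ _).symm) ?_ ?_ ?_ i j <;>
  fin_cases s <;> fin_cases t <;>
    simp [gammaPlus, gammaMinus, Matrix.mul_apply, Matrix.conjTranspose_apply]

/-- The Weitzenböck identity at the level of matrices. One has `Γ^iΓ^j = δ_ij` plus a skew,
self-dual part on `S⁺`; the latter sees only the self-dual part of `X_ij - X_ji`, which is zero. The
`X_ij` stand for products of two covariant derivatives. -/
theorem sum_gammaMinus_mul_gammaPlus (X : Fin 4 → Fin 4 → M)
    (hX : ∀ i j, selfDualPart (fun k l => X k l - X l k) i j = 0) (s t : Fin 2) :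
    ∑ i, ∑ j, (gammaMinus i * gammaPlus j) s t • X i j
      = (1 : Matrix (Fin 2) (Fin 2) ℂ) s t • ∑ i, X i i := by
  obtain ⟨e1, e2, e3⟩ := hodge_apply_of_skew (fun k l => X k l - X l k)
    fun i j => (neg_sub _ _).symm
  have h1 := hX 0 1
  have h2 := hX 0 2
  have h3 := hX 0 3
  rw [selfDualPart, smul_eq_zero_iff_right (by norm_num)] at h1 h2 h3
  rw [e1] at h1
  rw [e2] at h2
  rw [e3] at h3
  fin_cases s <;> fin_cases t <;>
    simp [Fin.sum_univ_succ, gammaPlus, gammaMinus,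
      Matrix.mul_apply, Matrix.conjTranspose_apply] 
  -- In each matrix entry the off-diagonal `X_ij` combine to these multiples of the three self-dual
  -- components, the coefficients being the entries of `i` times the Pauli matrices.
  · linear_combination (norm := module) Complex.I • h3
  · linear_combination (norm := module) Complex.I • h1 + h2
  · linear_combination (norm := module) Complex.I • h1 - h2
  · linear_combination (norm := module) -Complex.I • h3

end hodgeStar
end
end NCNahm

namespace NCNahm

noncomputable section

open SmoothTorus MulOpposite BalTensor

/-! ### Matrices on spinors, and the pairing in orthonormal frames -/

section spinAct

variable {E : Type*} [AddCommGroup E] [Module ℂ E]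

/-- The action of `2 × 2` matrices on `E ⊗ ℂ²`. -/
def spinAct : Matrix (Fin 2) (Fin 2) ℂ →ₗ[ℂ] (Fin 2 → E) →ₗ[ℂ] (Fin 2 → E) :=
  LinearMap.mk₂ ℂ (fun A ψ s => ∑ t, A s t • ψ t)
    (fun A B ψ => by ext s; simp only [Matrix.add_apply, add_smul, Finset.sum_add_distrib]; rfl)
    (fun c A ψ => by
      ext s
      simp only [Matrix.smul_apply, Pi.smul_apply, smul_assoc, Finset.smul_sum])
    (fun A ψ φ => by ext s; simp only [Pi.add_apply, smul_add, Finset.sum_add_distrib])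
    (fun c A ψ => by
      ext s
      simp only [Pi.smul_apply, Finset.smul_sum]
      exact Finset.sum_congr rfl fun t _ => smul_comm _ _ _)

theorem spinAct_apply (A : Matrix (Fin 2) (Fin 2) ℂ) (ψ : Fin 2 → E) (s : Fin 2) :
    spinAct A ψ s = ∑ t, A s t • ψ t := rfl

theorem spinAct_spinAct (A B : Matrix (Fin 2) (Fin 2) ℂ) (ψ : Fin 2 → E) :
    spinAct A (spinAct B ψ) = spinAct (A * B) ψ := by
  ext s
  simp only [spinAct_apply, Matrix.mul_apply, Finset.smul_sum, Finset.sum_smul, smul_smul]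
  exact Finset.sum_comm

theorem compLeft_spinAct (T : E →ₗ[ℂ] E) (A : Matrix (Fin 2) (Fin 2) ℂ) (ψ : Fin 2 → E) :
    T.compLeft (Fin 2) (spinAct A ψ) = spinAct A (T.compLeft (Fin 2) ψ) := by
  ext s
  simp only [LinearMap.compLeft_apply, Function.comp_apply, spinAct_apply, map_sum, map_smul]

end spinAct

section frames

theorem twoForm_inl_inl (Ω : Matrix (Fin 4 ⊕ Fin 4) (Fin 4 ⊕ Fin 4) ℂ) (v w : Fin 4 → ℝ) :
    twoForm Ω (Sum.elim v 0) (Sum.elim w 0) = twoForm Ω.toBlocks₁₁ v w := by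
  simp [twoForm, Fintype.sum_sum_type, Matrix.toBlocks₁₁]

theorem twoForm_inl_inr (Ω : Matrix (Fin 4 ⊕ Fin 4) (Fin 4 ⊕ Fin 4) ℂ) (v w : Fin 4 → ℝ) :
    twoForm Ω (Sum.elim v 0) (Sum.elim 0 w) = twoForm Ω.toBlocks₁₂ v w := by
  simp [twoForm, Fintype.sum_sum_type, Matrix.toBlocks₁₂]

theorem twoForm_inr_inr (Ω : Matrix (Fin 4 ⊕ Fin 4) (Fin 4 ⊕ Fin 4) ℂ) (v w : Fin 4 → ℝ) :
    twoForm Ω (Sum.elim 0 v) (Sum.elim 0 w) = twoForm Ω.toBlocks₂₂ v w := by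
  simp [twoForm, Fintype.sum_sum_type, Matrix.toBlocks₂₂]

theorem im_twoForm (σ : Matrix (Fin 4) (Fin 4) ℂ) (v w : Fin 4 → ℝ) :
    (twoForm σ v w).im = v ⬝ᵥ (realPairing σ).mulVec w := by
  simp only [twoForm, Complex.im_sum, dotProduct, Matrix.mulVec, realPairing, Matrix.map_apply,
    Finset.mul_sum]
  refine Finset.sum_congr rfl fun i _ => Finset.sum_congr rfl fun j _ => ?_
  simp [mul_assoc]

theorem IsOrthonormalFrame.mul_eq_one {g : Matrix (Fin 4) (Fin 4) ℝ} {b : Fin 4 → LieAlg}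
    (h : IsOrthonormalFrame g b) : Matrix.of b * g * (Matrix.of b).transpose = 1 := by
  ext i j
  rw [Matrix.one_apply, ← h i j, Matrix.mul_assoc, Matrix.mul_apply]
  rfl

/-- Orthonormality of `α` means `g⁻¹ = αᵀα`. Substituted into the transported inner product,
orthonormality of `β` becomes `OᵀO = 1` for the pairing matrix `O = α s βᵀ`. -/
theorem pairing_mul_transpose {g : Matrix (Fin 4) (Fin 4) ℝ} {σ : Matrix (Fin 4) (Fin 4) ℂ}
    {α β : Fin 4 → LieAlg} (hα : IsOrthonormalFrame g α)
    (hβ : IsOrthonormalFrame (dualInner g σ) β) :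
    (Matrix.of fun i j => α i ⬝ᵥ (realPairing σ).mulVec (β j))
      * (Matrix.of fun i j => α i ⬝ᵥ (realPairing σ).mulVec (β j)).transpose = 1 := by
  have hO : (Matrix.of fun i j => α i ⬝ᵥ (realPairing σ).mulVec (β j))
      = Matrix.of α * realPairing σ * (Matrix.of β).transpose := by
    ext i j
    rw [Matrix.mul_assoc, Matrix.mul_apply]
    rfl
  have hg : g⁻¹ = (Matrix.of α).transpose * Matrix.of α := by
    refine Matrix.inv_eq_right_inv ?_
    have := hα.mul_eq_one
    rw [Matrix.mul_assoc, mul_eq_one_comm] at this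
    rw [← Matrix.mul_assoc, this]
  have h := hβ.mul_eq_one
  rw [dualInner, hg] at h
  rw [mul_eq_one_comm, hO]
  simpa only [Matrix.transpose_mul, Matrix.transpose_transpose, Matrix.mul_assoc] using h

end frames

section operators

variable {θ θ' : SkewForm (Fin 4)}
variable {R P : Type*} [AddCommGroup R] [Module ℂ R] [Module (SmoothTorus θ)ᵐᵒᵖ R]
  [IsScalarTower ℂ (SmoothTorus θ)ᵐᵒᵖ R]
  [AddCommGroup P] [Module ℂ P] [Module (SmoothTorus (θ.diff θ')) P]
  [IsScalarTower ℂ (SmoothTorus (θ.diff θ')) P]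

/-! ### The inner product on spinors and orthogonal projections -/

section spinorInner

variable (hR : HermitianForm θ R) (hP : LeftHermitianForm (θ.diff θ') P)

theorem spinorInner_add_left (ψ ψ' φ : Spinors θ θ' R P) :
    spinorInner hR hP (ψ + ψ') φ = spinorInner hR hP ψ φ + spinorInner hR hP ψ' φ := by
  simp only [spinorInner, Pi.add_apply, map_add, LinearMap.add_apply, Finset.sum_add_distrib]

theorem spinorInner_add_right (ψ φ φ' : Spinors θ θ' R P) :
    spinorInner hR hP ψ (φ + φ') = spinorInner hR hP ψ φ + spinorInner hR hP ψ φ' := by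
  simp only [spinorInner, Pi.add_apply, map_add, Finset.sum_add_distrib]

theorem spinorInner_sub_left (ψ ψ' φ : Spinors θ θ' R P) :
    spinorInner hR hP (ψ - ψ') φ = spinorInner hR hP ψ φ - spinorInner hR hP ψ' φ := by
  simp only [spinorInner, Pi.sub_apply, map_sub, LinearMap.sub_apply, Finset.sum_sub_distrib]

theorem spinorInner_sub_right (ψ φ φ' : Spinors θ θ' R P) :
    spinorInner hR hP ψ (φ - φ') = spinorInner hR hP ψ φ - spinorInner hR hP ψ φ' := by
  simp only [spinorInner, Pi.sub_apply, map_sub, Finset.sum_sub_distrib]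

theorem spinorInner_sum_left {J : Type*} (s : Finset J) (ψ : J → Spinors θ θ' R P)
    (φ : Spinors θ θ' R P) :
    spinorInner hR hP (∑ j ∈ s, ψ j) φ = ∑ j ∈ s, spinorInner hR hP (ψ j) φ :=
  map_sum (AddMonoidHom.mk' (fun ψ => spinorInner hR hP ψ φ)
    fun a b => spinorInner_add_left hR hP a b φ) ψ s

theorem spinorInner_sum_right {J : Type*} (s : Finset J) (ψ : Spinors θ θ' R P)
    (φ : J → Spinors θ θ' R P) :
    spinorInner hR hP ψ (∑ j ∈ s, φ j) = ∑ j ∈ s, spinorInner hR hP ψ (φ j) :=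
  map_sum (AddMonoidHom.mk' (spinorInner hR hP ψ) (spinorInner_add_right hR hP ψ)) φ s

theorem star_spinorInner (ψ φ : Spinors θ θ' R P) :
    star (spinorInner hR hP ψ φ) = spinorInner hR hP φ ψ := by
  simp only [spinorInner, star_sum, star_tensorInner]

theorem spinorInner_op_smul_right (ψ φ : Spinors θ θ' R P) (b : (SmoothTorus θ')ᵐᵒᵖ) :
    spinorInner hR hP ψ (b • φ) = spinorInner hR hP ψ φ * b.unop := by
  simp only [spinorInner, Pi.smul_apply, tensorInner_op_smul_right, Finset.sum_mul]

theorem spinorInner_spinAct (A : Matrix (Fin 2) (Fin 2) ℂ) (ψ φ : Spinors θ θ' R P) :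
    spinorInner hR hP (spinAct A ψ) φ = spinorInner hR hP ψ (spinAct A.conjTranspose φ) := by
  simp only [spinorInner, spinAct_apply, map_sum, LinearMap.sum_apply, map_smulₛₗ,
    LinearMap.smul_apply, Matrix.conjTranspose_apply]
  exact Finset.sum_comm

theorem spinorInner_compLeft {T : BalTensor θ θ' R P →ₗ[ℂ] BalTensor θ θ' R P}
    (hT : ∀ x y, tensorInner hR hP (T x) y = tensorInner hR hP x (T y))
    (ψ φ : Spinors θ θ' R P) :
    spinorInner hR hP (T.compLeft (Fin 2) ψ) φ
      = spinorInner hR hP ψ (T.compLeft (Fin 2) φ) :=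
  Finset.sum_congr rfl fun s _ => hT (ψ s) (φ s)

variable {hR}

theorem isPositive_spinorInner (hRproj : hR.IsProjective) (ψ : Spinors θ θ' R P) :
    IsPositive (spinorInner hR hP ψ ψ) :=
  isPositive_sum _ fun s _ => isPositive_tensorInner hP hR hRproj (ψ s)

theorem eq_zero_of_spinorInner_self (hRproj : hR.IsProjective) {ψ : Spinors θ θ' R P}
    (h : spinorInner hR hP ψ ψ = 0) : ψ = 0 := by
  have hsum : ∑ s, (trace (tensorInner hR hP (ψ s) (ψ s))).re = 0 := by
    have h' := congrArg (fun a : SmoothTorus θ' => (trace a).re) h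
    rw [spinorInner] at h'
    exact (map_sum (AddMonoidHom.mk' (fun a : SmoothTorus θ' => (trace a).re) fun a b => rfl)
      _ _).symm.trans h'
  rw [Finset.sum_eq_zero_iff_of_nonneg fun s _ =>
    (isPositive_tensorInner hP hR hRproj (ψ s)).trace_re_nonneg] at hsum
  ext s
  exact eq_zero_of_trace_tensorInner hP hR hRproj (hsum s (Finset.mem_univ s))

variable {hP}

theorem IsOrthogonalProjection.apply_of_mem
    {N : Submodule (SmoothTorus θ')ᵐᵒᵖ (Spinors θ θ' R P)}
    {Q : Spinors θ θ' R P →ₗ[ℂ] Spinors θ θ' R P} (hQ : IsOrthogonalProjection hR hP N Q)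
    {ψ : Spinors θ θ' R P} (h : ψ ∈ N) : Q ψ = ψ := by
  obtain ⟨φ, rfl⟩ := (hQ.range_eq ψ).2 h
  exact hQ.idempotent φ

/-- The difference `d = Q'ψ - Qψ` lies in `N`, where both projections are the identity. Hence `⟨Q'ψ,
d⟩ = ⟨ψ, d⟩ = ⟨Qψ, d⟩`, so `⟨d, d⟩ = 0`. -/
theorem IsOrthogonalProjection.unique (hRproj : hR.IsProjective)
    {N : Submodule (SmoothTorus θ')ᵐᵒᵖ (Spinors θ θ' R P)}
    {Q Q' : Spinors θ θ' R P →ₗ[ℂ] Spinors θ θ' R P} (hQ : IsOrthogonalProjection hR hP N Q)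
    (hQ' : IsOrthogonalProjection hR hP N Q') : Q' = Q := by
  refine LinearMap.ext fun ψ => sub_eq_zero.1 (eq_zero_of_spinorInner_self hP hRproj ?_)
  have hd : Q' ψ - Q ψ ∈ N :=
    N.sub_mem ((hQ'.range_eq _).1 ⟨ψ, rfl⟩) ((hQ.range_eq _).1 ⟨ψ, rfl⟩)
  rw [spinorInner_sub_left, hQ.hermitian, hQ'.hermitian, hQ.apply_of_mem hd, hQ'.apply_of_mem hd,
    sub_self]

end spinorInner

/-! ### Dirac operators, the Weitzenböck formula and mixed commutators -/

variable {hR : HermitianForm θ R} {hP : LeftHermitianForm (θ.diff θ') P}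
variable (nR : Connection hR) (nP : LeftConnection hP)

theorem dirac_apply (Γ : Fin 4 → Matrix (Fin 2) (Fin 2) ℂ) (α : Fin 4 → LieAlg)
    (ψ : Spinors θ θ' R P) : dirac nR nP Γ α ψ
      = ∑ i, spinAct (Γ i) ((tensorNabla nR nP (α i)).compLeft (Fin 2) ψ) := by
  ext s
  rw [Finset.sum_apply]
  simp only [dirac, LinearMap.pi_apply, LinearMap.sum_apply, LinearMap.smul_apply,
    LinearMap.comp_apply, LinearMap.proj_apply, spinAct_apply, LinearMap.compLeft_apply,
    Function.comp_apply]

/-- No sign appears: the covariant derivatives are symmetric in this convention, and `gammaMinus` is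
the adjoint of `gammaPlus`. -/
theorem spinorInner_dirac_gammaPlus (α : Fin 4 → LieAlg) (ψ φ : Spinors θ θ' R P) :
    spinorInner hR hP (dirac nR nP gammaPlus α ψ) φ
      = spinorInner hR hP ψ (dirac nR nP gammaMinus α φ) := by
  rw [dirac_apply, dirac_apply, spinorInner_sum_left, spinorInner_sum_right]
  refine Finset.sum_congr rfl fun i _ => ?_
  rw [spinorInner_spinAct, spinorInner_compLeft _ _ (tensorInner_tensorNabla nR nP (α i)),
    compLeft_spinAct]
  rfl

theorem spinorInner_dirac_gammaMinus (α : Fin 4 → LieAlg) (ψ φ : Spinors θ θ' R P) :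
    spinorInner hR hP (dirac nR nP gammaMinus α ψ) φ
      = spinorInner hR hP ψ (dirac nR nP gammaPlus α φ) := by
  rw [← star_spinorInner, ← spinorInner_dirac_gammaPlus, star_spinorInner]

theorem tensorInner_laplacian (α : Fin 4 → LieAlg) (x y : BalTensor θ θ' R P) :
    tensorInner hR hP (laplacian nR nP α x) y = tensorInner hR hP x (laplacian nR nP α y) := by
  simp only [laplacian, LinearMap.sum_apply, map_sum, LinearMap.comp_apply,
    tensorInner_tensorNabla]

theorem laplacian_op_smul (α : Fin 4 → LieAlg) (b : (SmoothTorus θ')ᵐᵒᵖ)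
    (x : BalTensor θ θ' R P) : laplacian nR nP α (b • x) = b • laplacian nR nP α x := by
  simp only [laplacian, LinearMap.sum_apply, LinearMap.comp_apply, tensorNabla_op_smul,
    Finset.smul_sum]

variable {nP} {Ω : Matrix (Fin 4 ⊕ Fin 4) (Fin 4 ⊕ Fin 4) ℂ}

theorem selfDualPart_tmul (F : Fin 4 → Fin 4 → R) (p : P) (i j : Fin 4) :
    tmul θ θ' (selfDualPart F i j) p = selfDualPart (fun k l => tmul θ θ' (F k l) p) i j :=
  map_selfDualPart ((mk θ θ').flip p) F i j

theorem selfDualPart_opCommutator_tensorNabla (hΩ : HasConstantCurvature nP Ω)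
    {α : Fin 4 → LieAlg} (hF : ∀ i j,
      selfDualPart (fun k l => opCommutator (nR.nabla (α k)) (nR.nabla (α l))) i j
        + selfDualPart (fun k l => twoForm Ω.toBlocks₁₁ (α k) (α l)) i j • LinearMap.id = 0)
    (i j : Fin 4) :
    selfDualPart (fun k l =>
      opCommutator (tensorNabla nR nP (α k)) (tensorNabla nR nP (α l))) i j = 0 := by
  have hΩ' : ∀ X Y, opCommutator (nP.nabla X) (nP.nabla Y) = twoForm Ω X Y • LinearMap.id := hΩ
  refine hom_ext fun r p => ?_
  have h1 := selfDualPart_linearMap_apply (fun k l =>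
      opCommutator (tensorNabla nR nP (α k)) (tensorNabla nR nP (α l))) (tmul θ θ' r p) i j
  simp only [opCommutator_tensorNabla_tmul,
    hΩ', twoForm_inl_inl, LinearMap.smul_apply, LinearMap.id_apply, tmul_smul] at h1
  rw [h1, selfDualPart_add, selfDualPart_smul, LinearMap.zero_apply]
  have h2 : tmul θ θ' (selfDualPart (fun k l =>
      opCommutator (nR.nabla (α k)) (nR.nabla (α l))) i j r) p = selfDualPart (fun k l =>
      tmul θ θ' (opCommutator (nR.nabla (α k)) (nR.nabla (α l)) r) p) i j := by
    rw [selfDualPart_linearMap_apply, selfDualPart_tmul]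
  have h3 := LinearMap.congr_fun (hF i j) r
  rw [LinearMap.add_apply, LinearMap.smul_apply, LinearMap.id_apply, LinearMap.zero_apply] at h3
  -- The scalar coming from the curvature of `P` is moved to the factor `R`, where `F⁺ + ω⁺ = 0`
  -- applies.
  rw [← h2, ← BalTensor.smul_tmul, ← add_tmul, h3]
  exact LinearMap.map_zero₂ (mk θ θ') p

/-- The Laplacian acts diagonally on spin indices, so an inverse on `R ⊗_{A_θ} P` inverts `D⁻D⁺` and
commutes with Gamma matrices. -/
theorem dirac_gammaMinus_gammaPlus {α : Fin 4 → LieAlg}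
    (h : ∀ i j, selfDualPart (fun k l =>
      opCommutator (tensorNabla nR nP (α k)) (tensorNabla nR nP (α l))) i j = 0)
    (ψ : Spinors θ θ' R P) :
    dirac nR nP gammaMinus α (dirac nR nP gammaPlus α ψ)
      = (laplacian nR nP α).compLeft (Fin 2) ψ := by
  have key := sum_gammaMinus_mul_gammaPlus
    (fun i j => tensorNabla nR nP (α i) ∘ₗ tensorNabla nR nP (α j)) h
  have h1 : dirac nR nP gammaMinus α (dirac nR nP gammaPlus α ψ) = ∑ i, ∑ j,
      spinAct (gammaMinus i * gammaPlus j)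
        ((tensorNabla nR nP (α i) ∘ₗ tensorNabla nR nP (α j)).compLeft (Fin 2) ψ) := by
    rw [dirac_apply, dirac_apply]
    refine Finset.sum_congr rfl fun i _ => ?_
    rw [map_sum, map_sum]
    refine Finset.sum_congr rfl fun j _ => ?_
    rw [compLeft_spinAct, spinAct_spinAct]
    rfl
  rw [h1]
  ext s
  have h2 : ∀ t, ∑ i, ∑ j, (gammaMinus i * gammaPlus j) s t
      • tensorNabla nR nP (α i) (tensorNabla nR nP (α j) (ψ t))
      = (1 : Matrix (Fin 2) (Fin 2) ℂ) s t • laplacian nR nP α (ψ t) := fun t => by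
    have := congrArg (fun T => T (ψ t)) (key s t)
    simpa only [laplacian, LinearMap.sum_apply, LinearMap.smul_apply, LinearMap.comp_apply]
      using this
  simp only [Finset.sum_apply, spinAct_apply, LinearMap.compLeft_apply, Function.comp_apply,
    LinearMap.comp_apply]
  rw [Finset.sum_comm_cycle]
  simp [h2, Matrix.one_apply]

theorem tensorNabla_comp_tensorNablaHat (hΩ : HasConstantCurvature nP Ω) (v w : LieAlg)
    (x : BalTensor θ θ' R P) :
    tensorNabla nR nP v (tensorNablaHat nP w x)
      = tensorNablaHat nP w (tensorNabla nR nP v x) + twoForm Ω.toBlocks₁₂ v w • x := by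
  have h : opCommutator (tensorNabla nR nP v) (tensorNablaHat nP w)
      = twoForm Ω.toBlocks₁₂ v w • LinearMap.id := hom_ext fun r p => by
    rw [opCommutator_tensorNabla_tensorNablaHat_tmul, hΩ, twoForm_inl_inr]
    exact tmul_smul θ θ' _ r p
  exact sub_eq_iff_eq_add'.1 (LinearMap.congr_fun h x)

theorem tensorNablaHat_comp_tensorNablaHat (hΩ : HasConstantCurvature nP Ω) (v w : LieAlg)
    (x : BalTensor θ θ' R P) :
    tensorNablaHat nP v (tensorNablaHat nP w x)
      = tensorNablaHat nP w (tensorNablaHat nP v x) + twoForm Ω.toBlocks₂₂ v w • x := by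
  have h : opCommutator (tensorNablaHat (R := R) nP v) (tensorNablaHat nP w)
      = twoForm Ω.toBlocks₂₂ v w • LinearMap.id := hom_ext fun r p => by
    rw [opCommutator_tensorNablaHat_tmul, hΩ, twoForm_inr_inr]
    exact tmul_smul θ θ' _ r p
  exact sub_eq_iff_eq_add'.1 (LinearMap.congr_fun h x)

/-- The mixed curvature of `∇ ⊕ ∇̂` is purely imaginary, because the connection is Hermitian. -/
theorem re_twoForm_mixed [Nontrivial (BalTensor θ θ' R P)] (hRproj : hR.IsProjective)
    (nR : Connection hR) (hΩ : HasConstantCurvature nP Ω) (v w : LieAlg) :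
    (twoForm Ω.toBlocks₁₂ v w).re = 0 := by
  obtain ⟨x, hx⟩ := exists_ne (0 : BalTensor θ θ' R P)
  -- The full trace kills `δ_w`, so `∇̂_w` becomes symmetric for the scalar inner product.
  have hsymm : ∀ y z : BalTensor θ θ' R P, trace (tensorInner hR hP (tensorNablaHat nP w y) z)
      = trace (tensorInner hR hP y (tensorNablaHat nP w z)) := fun y z => by
    have h := congrArg trace (deriv_tensorInner nP w y z (hR := hR))
    rw [trace_deriv] at h
    exact (sub_eq_zero.1 h.symm).symm
  have h := congrArg (fun y => trace (tensorInner hR hP x y))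
    (tensorNabla_comp_tensorNablaHat nR hΩ v w x)
  have h' := congrArg (fun y => trace (tensorInner hR hP y x))
    (tensorNabla_comp_tensorNablaHat nR hΩ v w x)
  simp only [map_add, LinearMap.add_apply, map_smul, map_smulₛₗ, LinearMap.smul_apply, trace_add,
    trace_smul, tensorInner_tensorNabla, hsymm] at h h'
  -- A commutator of symmetric operators is skew; evaluated at `x`, this says that the scalar and
  -- its conjugate cancel.
  have h0 : (twoForm Ω.toBlocks₁₂ v w + starRingEnd ℂ (twoForm Ω.toBlocks₁₂ v w))
      * trace (tensorInner hR hP x x) = 0 := by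
    linear_combination -h - h'
  have hne : trace (tensorInner hR hP x x) ≠ 0 := fun h0 =>
    hx (eq_zero_of_trace_tensorInner hP hR hRproj (by rw [h0, Complex.zero_re]))
  have := congrArg Complex.re ((mul_eq_zero.1 h0).resolve_right hne)
  simp only [Complex.add_re, Complex.conj_re, Complex.zero_re] at this
  linarith

theorem twoForm_mixed_eq [Nontrivial (BalTensor θ θ' R P)] (hRproj : hR.IsProjective)
    (nR : Connection hR) (hΩ : HasConstantCurvature nP Ω) (v w : LieAlg) :
    twoForm Ω.toBlocks₁₂ v w
      = Complex.I * ((v ⬝ᵥ (realPairing Ω.toBlocks₁₂).mulVec w : ℝ) : ℂ) := by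
  apply Complex.ext
  · simpa using re_twoForm_mixed hRproj nR hΩ v w
  · simpa using im_twoForm _ v w

/-- The mixed curvature is scalar, so the commutator of `D` with `∇̂_w` contains no derivatives: it
is Clifford multiplication by `σ(·, w)`. -/
theorem dirac_spinorNablaHat (hΩ : HasConstantCurvature nP Ω)
    (Γ : Fin 4 → Matrix (Fin 2) (Fin 2) ℂ) (α : Fin 4 → LieAlg) (w : LieAlg)
    (ψ : Spinors θ θ' R P) :
    dirac nR nP Γ α (spinorNablaHat nP w ψ) = spinorNablaHat nP w (dirac nR nP Γ α ψ)
      + spinAct (∑ i, twoForm Ω.toBlocks₁₂ (α i) w • Γ i) ψ := by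
  have h : ∀ i, (tensorNabla nR nP (α i)).compLeft (Fin 2) (spinorNablaHat nP w ψ)
      = (tensorNablaHat nP w).compLeft (Fin 2) ((tensorNabla nR nP (α i)).compLeft (Fin 2) ψ)
        + twoForm Ω.toBlocks₁₂ (α i) w • ψ := fun i =>
    funext fun s => tensorNabla_comp_tensorNablaHat nR hΩ (α i) w (ψ s)
  have h' : ∀ φ : Spinors θ θ' R P,
      spinorNablaHat nP w φ = (tensorNablaHat nP w).compLeft (Fin 2) φ := fun φ => rfl
  simp only [dirac_apply, h, map_add, map_sum, h' (∑ i, _), compLeft_spinAct, LinearMap.sum_apply,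
    map_smul, LinearMap.smul_apply, Finset.sum_add_distrib]

/-! ### The projection onto `ker D⁻` and the curvature of the transform -/

section projection

/-- The projection `1 - D⁺ G D⁻` onto `ker D⁻`, for the inverse `G` of the Laplacian. -/
def nahmProjection (nP : LeftConnection hP) (α : Fin 4 → LieAlg)
    (G : BalTensor θ θ' R P →ₗ[ℂ] BalTensor θ θ' R P) :
    Spinors θ θ' R P →ₗ[ℂ] Spinors θ θ' R P :=
  LinearMap.id - dirac nR nP gammaPlus α ∘ₗ G.compLeft (Fin 2) ∘ₗ dirac nR nP gammaMinus α

theorem nahmProjection_apply (α : Fin 4 → LieAlg)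
    (G : BalTensor θ θ' R P →ₗ[ℂ] BalTensor θ θ' R P) (ψ : Spinors θ θ' R P) :
    nahmProjection nR nP α G ψ = ψ
      - dirac nR nP gammaPlus α (G.compLeft (Fin 2) (dirac nR nP gammaMinus α ψ)) := rfl

variable {nR} {α : Fin 4 → LieAlg} {G : BalTensor θ θ' R P →ₗ[ℂ] BalTensor θ θ' R P}

/-- The inverse of a symmetric operator is symmetric. -/
theorem tensorInner_green (hLG : ∀ x, laplacian nR nP α (G x) = x) (x y : BalTensor θ θ' R P) :
    tensorInner hR hP (G x) y = tensorInner hR hP x (G y) := by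
  have h := tensorInner_laplacian nR nP α (G x) (G y)
  rw [hLG, hLG] at h
  exact h.symm

theorem green_op_smul (hGL : ∀ x, G (laplacian nR nP α x) = x)
    (hLG : ∀ x, laplacian nR nP α (G x) = x) (b : (SmoothTorus θ')ᵐᵒᵖ)
    (x : BalTensor θ θ' R P) : G (b • x) = b • G x := by
  conv_lhs => rw [← hLG x, ← laplacian_op_smul, hGL]

theorem nahmProjection_op_smul (hGL : ∀ x, G (laplacian nR nP α x) = x)
    (hLG : ∀ x, laplacian nR nP α (G x) = x) (b : (SmoothTorus θ')ᵐᵒᵖ)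
    (ψ : Spinors θ θ' R P) :
    nahmProjection nR nP α G (b • ψ) = b • nahmProjection nR nP α G ψ := by
  have hG : ∀ φ : Spinors θ θ' R P, G.compLeft (Fin 2) (b • φ) = b • G.compLeft (Fin 2) φ :=
    fun φ => funext fun s => green_op_smul hGL hLG b (φ s)
  rw [nahmProjection_apply, nahmProjection_apply, dirac_op_smul, hG, dirac_op_smul, smul_sub]

theorem nahmProjection_of_mem {ψ : Spinors θ θ' R P} (hψ : ψ ∈ nahmModule nR nP α) :
    nahmProjection nR nP α G ψ = ψ := by
  have h : dirac nR nP gammaMinus α ψ = 0 := hψ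
  rw [nahmProjection_apply, h, map_zero, map_zero, sub_zero]

/-- `D⁺ G D⁻ D⁺ = D⁺ G Δ = D⁺`. -/
theorem nahmProjection_dirac_gammaPlus (hGL : ∀ x, G (laplacian nR nP α x) = x)
    (hD : ∀ ψ : Spinors θ θ' R P, dirac nR nP gammaMinus α (dirac nR nP gammaPlus α ψ)
      = (laplacian nR nP α).compLeft (Fin 2) ψ) (ψ : Spinors θ θ' R P) :
    nahmProjection nR nP α G (dirac nR nP gammaPlus α ψ) = 0 := by
  have hG : G.compLeft (Fin 2) ((laplacian nR nP α).compLeft (Fin 2) ψ) = ψ :=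
    funext fun s => hGL (ψ s)
  rw [nahmProjection_apply, hD, hG, sub_self]

/-- `D⁻ D⁺ G D⁻ = Δ G D⁻ = D⁻` puts the range in `ker D⁻`, where the correction term vanishes;
symmetry holds because `G` is symmetric and `D⁺`, `D⁻` are adjoint. -/
theorem isOrthogonalProjection_nahmProjection (hLG : ∀ x, laplacian nR nP α (G x) = x)
    (hD : ∀ ψ : Spinors θ θ' R P, dirac nR nP gammaMinus α (dirac nR nP gammaPlus α ψ)
      = (laplacian nR nP α).compLeft (Fin 2) ψ) :
    IsOrthogonalProjection hR hP (nahmModule nR nP α) (nahmProjection nR nP α G) := by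
  have hmem : ∀ ψ, nahmProjection nR nP α G ψ ∈ nahmModule nR nP α := fun ψ => by
    have hG : (laplacian nR nP α).compLeft (Fin 2)
        (G.compLeft (Fin 2) (dirac nR nP gammaMinus α ψ)) = dirac nR nP gammaMinus α ψ :=
      funext fun s => hLG _
    change dirac nR nP gammaMinus α _ = 0
    rw [nahmProjection_apply, map_sub, hD, hG, sub_self]
  refine ⟨fun ψ φ => ?_, fun ψ => nahmProjection_of_mem (hmem ψ), fun ψ => ⟨?_, fun hψ =>
    ⟨ψ, nahmProjection_of_mem hψ⟩⟩⟩
  · rw [nahmProjection_apply, nahmProjection_apply, spinorInner_sub_left, spinorInner_sub_right,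
      spinorInner_dirac_gammaPlus, spinorInner_compLeft _ _ (tensorInner_green hLG),
      spinorInner_dirac_gammaMinus]
  · rintro ⟨φ, rfl⟩
    exact hmem φ

/-- The product of two covariant derivatives of the Nahm transform. -/
theorem nahmProjection_spinorNablaHat_comp (hGL : ∀ x, G (laplacian nR nP α x) = x)
    (hD : ∀ ψ : Spinors θ θ' R P, dirac nR nP gammaMinus α (dirac nR nP gammaPlus α ψ)
      = (laplacian nR nP α).compLeft (Fin 2) ψ) (hΩ : HasConstantCurvature nP Ω)
    (v w : LieAlg) {ψ : Spinors θ θ' R P} (hψ : ψ ∈ nahmModule nR nP α) :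
    nahmProjection nR nP α G (spinorNablaHat nP v
        (nahmProjection nR nP α G (spinorNablaHat nP w ψ)))
      = nahmProjection nR nP α G (spinorNablaHat nP v (spinorNablaHat nP w ψ))
        + nahmProjection nR nP α G (spinAct
          (∑ j, ∑ i, (twoForm Ω.toBlocks₁₂ (α j) v * twoForm Ω.toBlocks₁₂ (α i) w) •
            (gammaPlus j * gammaMinus i)) (G.compLeft (Fin 2) ψ)) := by
  have h : dirac nR nP gammaMinus α ψ = 0 := hψ
  set χ := G.compLeft (Fin 2) (spinAct (∑ i, twoForm Ω.toBlocks₁₂ (α i) w • gammaMinus i) ψ)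
    with hχ
  -- As `D⁻ψ = 0`, only the commutator remains of `D⁻∇̂_w ψ`.
  have h1 : nahmProjection nR nP α G (spinorNablaHat nP w ψ)
      = spinorNablaHat nP w ψ - dirac nR nP gammaPlus α χ := by
    rw [nahmProjection_apply, dirac_spinorNablaHat nR hΩ, h, map_zero, zero_add]
  -- Since `P D⁺ = 0`, commuting `∇̂_v` past `D⁺` leaves `P ∇̂_v D⁺ χ = -P σ(v)Γ⁺ χ`, without
  -- derivatives.
  have h2 := congrArg (nahmProjection nR nP α G) (dirac_spinorNablaHat nR hΩ gammaPlus α v χ)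
  rw [nahmProjection_dirac_gammaPlus hGL hD, map_add, eq_comm, add_comm] at h2
  rw [h1, map_sub, map_sub, sub_eq_add_neg, ← eq_neg_of_add_eq_zero_left h2, hχ,
    compLeft_spinAct, spinAct_spinAct]
  simp only [Finset.sum_mul_sum, smul_mul_smul_comm]

/-- The curvature is `ω̂` plus a linear image of the matrices `B k l` below, and `B` is a rotation
of the antiselfdual Gamma products on `S⁻`. -/
theorem selfDualPart_nahm_curvature (hRproj : hR.IsProjective)
    (hGL : ∀ x, G (laplacian nR nP α x) = x)
    (hD : ∀ ψ : Spinors θ θ' R P, dirac nR nP gammaMinus α (dirac nR nP gammaPlus α ψ)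
      = (laplacian nR nP α).compLeft (Fin 2) ψ) (hΩ : HasConstantCurvature nP Ω)
    {g : Matrix (Fin 4) (Fin 4) ℝ} (hα : IsOrthonormalFrame g α)
    {β : Fin 4 → LieAlg} (hβ : IsOrthonormalFrame (dualInner g Ω.toBlocks₁₂) β)
    (hαβ : IsPositivelyOriented Ω.toBlocks₁₂ α β) {ψ : Spinors θ θ' R P}
    (hψ : ψ ∈ nahmModule nR nP α) (i j : Fin 4) :
    selfDualPart (fun k l =>
        nahmProjection nR nP α G (spinorNablaHat nP (β k)
          (nahmProjection nR nP α G (spinorNablaHat nP (β l) ψ)))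
        - nahmProjection nR nP α G (spinorNablaHat nP (β l)
          (nahmProjection nR nP α G (spinorNablaHat nP (β k) ψ)))) i j
      = selfDualPart (fun k l => twoForm Ω.toBlocks₂₂ (β k) (β l)) i j • ψ := by
  -- That `σ` is purely imaginary is derived from a nonzero vector; for the zero module the claim is
  -- trivial.
  cases subsingleton_or_nontrivial (BalTensor θ θ' R P) with
  | inl _ => exact Subsingleton.elim _ _
  | inr _ =>
  set O : Matrix (Fin 4) (Fin 4) ℝ :=
    Matrix.of fun i j => α i ⬝ᵥ (realPairing Ω.toBlocks₁₂).mulVec (β j) with hO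
  have hOO : O * O.transpose = 1 := pairing_mul_transpose hα hβ
  -- Orthogonality leaves `±1`, and the orientation selects `+1`.
  have hdet : O.det = 1 := by
    have h := congrArg Matrix.det hOO
    rw [Matrix.det_mul, Matrix.det_transpose, Matrix.det_one] at h
    have h0 : 0 < O.det := hαβ
    nlinarith
  set A : Matrix (Fin 4) (Fin 4) ℂ := O.map Complex.ofRealHom with hA
  have hAA : A * A.transpose = 1 := by
    rw [hA, ← Matrix.transpose_map, ← Matrix.map_mul, hOO]
    exact Matrix.map_one _ (map_zero _) (map_one _)
  have hAdet : A.det = 1 := by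
    have := RingHom.map_det Complex.ofRealHom O
    rw [hdet, map_one] at this
    exact this.symm
  have hσ : ∀ i k, twoForm Ω.toBlocks₁₂ (α i) (β k) = Complex.I * A i k := fun i k =>
    twoForm_mixed_eq hRproj nR hΩ _ _
  -- The order of the two Gamma products is reversed because `σ = iO`, and the product of two
  -- factors `i` is `-1`.
  set B : Fin 4 → Fin 4 → Matrix (Fin 2) (Fin 2) ℂ := fun k l => ∑ j, ∑ i,
    (A j k * A i l) • (gammaPlus i * gammaMinus j - gammaPlus j * gammaMinus i) with hB
  have hBsd : selfDualPart B i j = 0 := by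
    ext s t
    have h1 := map_selfDualPart (Matrix.entryLinearMap ℂ ℂ s t) B i j
    refine h1.trans ?_
    have h2 : (fun k l => Matrix.entryLinearMap ℂ ℂ s t (B k l))
        = fun k l => ∑ j, ∑ i, A j k * A i l * -((gammaPlus j * gammaMinus i) s t
          - (gammaPlus i * gammaMinus j) s t) := by
      funext k l
      simp only [hB, map_sum, map_smul, Matrix.entryLinearMap_apply, Matrix.sub_apply,
        smul_eq_mul, neg_sub]
    have h3 : ∀ k l, selfDualPart (fun j i => -((gammaPlus j * gammaMinus i) s t
          - (gammaPlus i * gammaMinus j) s t)) k l = 0 := fun k l => by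
      have := map_selfDualPart (-LinearMap.id : ℂ →ₗ[ℂ] ℂ) (fun j i =>
        (gammaPlus j * gammaMinus i) s t - (gammaPlus i * gammaMinus j) s t) k l
      rw [selfDualPart_gammaPlus_mul_gammaMinus, map_zero] at this
      exact this.symm
    -- The self-dual part may be taken before the rotation by `A`, where it is that of the Gamma
    -- products.
    rw [h2, selfDualPart_rotate hAA hAdet]
    simp only [h3, mul_zero, Finset.sum_const_zero]
    rfl
  have hcurv : ∀ k l,
      nahmProjection nR nP α G (spinorNablaHat nP (β k)
          (nahmProjection nR nP α G (spinorNablaHat nP (β l) ψ)))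
        - nahmProjection nR nP α G (spinorNablaHat nP (β l)
          (nahmProjection nR nP α G (spinorNablaHat nP (β k) ψ)))
      = twoForm Ω.toBlocks₂₂ (β k) (β l) • ψ
        + (nahmProjection nR nP α G ∘ₗ spinAct.flip (G.compLeft (Fin 2) ψ)) (B k l) := by
    intro k l
    have h1 : spinorNablaHat nP (β k) (spinorNablaHat nP (β l) ψ)
        = spinorNablaHat nP (β l) (spinorNablaHat nP (β k) ψ)
          + twoForm Ω.toBlocks₂₂ (β k) (β l) • ψ :=
      funext fun s => tensorNablaHat_comp_tensorNablaHat hΩ _ _ _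
    have h2 : B k l = ∑ j, ∑ i, (twoForm Ω.toBlocks₁₂ (α j) (β k)
          * twoForm Ω.toBlocks₁₂ (α i) (β l)) • (gammaPlus j * gammaMinus i)
        - ∑ j, ∑ i, (twoForm Ω.toBlocks₁₂ (α j) (β l)
          * twoForm Ω.toBlocks₁₂ (α i) (β k)) • (gammaPlus j * gammaMinus i) := by
      have hI : ∀ a b : ℂ, Complex.I * a * (Complex.I * b) = -(a * b) := fun a b => by
        linear_combination a * b * Complex.I_mul_I
      simp only [hB, hσ, hI, smul_sub, Finset.sum_sub_distrib, neg_smul, Finset.sum_neg_distrib]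
      rw [Finset.sum_comm, sub_neg_eq_add, neg_add_eq_sub]
      simp only [mul_comm]
    rw [nahmProjection_spinorNablaHat_comp hGL hD hΩ _ _ hψ,
      nahmProjection_spinorNablaHat_comp hGL hD hΩ _ _ hψ, h1, map_add, map_smul,
      nahmProjection_of_mem hψ, h2, LinearMap.comp_apply, LinearMap.flip_apply, map_sub,
      LinearMap.sub_apply, map_sub]
    abel
  simp only [hcurv]
  rw [selfDualPart_add, selfDualPart_smul, ← map_selfDualPart, hBsd, map_zero, add_zero]

end projection

/-! ### The Hermitian module `ker D⁻` and its projected connection -/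

section transform

variable (hR hP) in
/-- The Hermitian structure of a submodule of `(R ⊗_{A_θ} P) ⊗ S^±`. -/
def spinorHermitianForm (hRproj : hR.IsProjective)
    (N : Submodule (SmoothTorus θ')ᵐᵒᵖ (Spinors θ θ' R P)) : HermitianForm θ' N where
  inner ψ φ := spinorInner hR hP ψ φ
  inner_add_right ψ φ φ' := spinorInner_add_right hR hP ψ φ φ'
  inner_smul_right ψ φ b := spinorInner_op_smul_right hR hP ψ φ (op b)
  star_inner ψ φ := star_spinorInner hR hP ψ φ
  inner_pos ψ := isPositive_spinorInner hP hRproj ψ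
  definite _ h := Subtype.ext (eq_zero_of_spinorInner_self hP hRproj h)

variable {nR}

theorem spinorNablaHat_op_smul (w : LieAlg) (b : SmoothTorus θ') (ψ : Spinors θ θ' R P) :
    spinorNablaHat nP w (op b • ψ)
      = op b • spinorNablaHat nP w ψ + op (deriv w b) • ψ :=
  funext fun s => tensorNablaHat_op_smul nP w b (ψ s)

theorem deriv_spinorInner (w : LieAlg) (ψ φ : Spinors θ θ' R P) :
    deriv w (spinorInner hR hP ψ φ) = spinorInner hR hP ψ (spinorNablaHat nP w φ)
      - spinorInner hR hP (spinorNablaHat nP w ψ) φ := by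
  simp only [spinorInner, map_sum, deriv_tensorInner nP, Finset.sum_sub_distrib]
  rfl

theorem tensorNablaHat_add (v w : LieAlg) :
    tensorNablaHat (R := R) nP (v + w) = tensorNablaHat nP v + tensorNablaHat nP w :=
  hom_ext fun r p => by
    have h : (Sum.elim 0 (v + w) : Fin 4 ⊕ Fin 4 → ℝ) =
        Sum.elim (0 : Fin 4 → ℝ) v + Sum.elim (0 : Fin 4 → ℝ) w := by
      ext (i | i) <;> simp
    rw [LinearMap.add_apply, tensorNablaHat_tmul, tensorNablaHat_tmul, tensorNablaHat_tmul, h,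
      nP.nabla_add, LinearMap.add_apply, tmul_add]

theorem tensorNablaHat_smul (c : ℝ) (w : LieAlg) :
    tensorNablaHat (R := R) nP (c • w) = (c : ℂ) • tensorNablaHat nP w :=
  hom_ext fun r p => by
    have h : (Sum.elim 0 (c • w) : Fin 4 ⊕ Fin 4 → ℝ) =
        c • Sum.elim (0 : Fin 4 → ℝ) w := by
      ext (i | i) <;> simp
    rw [LinearMap.smul_apply, tensorNablaHat_tmul, tensorNablaHat_tmul, h,
      nP.nabla_smul, LinearMap.smul_apply, tmul_smul]

variable (nP) in
/-- The connection `Q ∘ ∇̂` on the range of an orthogonal projection `Q`. -/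
def projectedConnection (hRproj : hR.IsProjective)
    {N : Submodule (SmoothTorus θ')ᵐᵒᵖ (Spinors θ θ' R P)}
    {Q : Spinors θ θ' R P →ₗ[ℂ] Spinors θ θ' R P} (hQ : IsOrthogonalProjection hR hP N Q)
    (hQb : ∀ (b : (SmoothTorus θ')ᵐᵒᵖ) ψ, Q (b • ψ) = b • Q ψ) :
    Connection (spinorHermitianForm hR hP hRproj N) where
  nabla w :=
    { toFun := fun ψ => ⟨Q (spinorNablaHat nP w ψ), (hQ.range_eq _).1 ⟨_, rfl⟩⟩
      map_add' := fun ψ φ => Subtype.ext <| by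
        change Q (spinorNablaHat nP w ((ψ : Spinors θ θ' R P) + φ)) = _
        rw [map_add, map_add]
        rfl
      map_smul' := fun c ψ => Subtype.ext <| by
        change Q (spinorNablaHat nP w (c • (ψ : Spinors θ θ' R P))) = _
        rw [map_smul, map_smul]
        rfl }
  nabla_add v w := LinearMap.ext fun ψ => Subtype.ext <| by
    change Q (spinorNablaHat nP (v + w) ψ)
      = Q (spinorNablaHat nP v ψ) + Q (spinorNablaHat nP w ψ)
    rw [← map_add]
    congr 1
    ext s
    exact LinearMap.congr_fun (tensorNablaHat_add v w) _
  nabla_smul c w := LinearMap.ext fun ψ => Subtype.ext <| by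
    change Q (spinorNablaHat nP (c • w) ψ) = (c : ℂ) • Q (spinorNablaHat nP w ψ)
    rw [← map_smul]
    congr 1
    ext s
    exact LinearMap.congr_fun (tensorNablaHat_smul c w) _
  leibniz w b ψ := Subtype.ext <| by
    change Q (spinorNablaHat nP w (op b • (ψ : Spinors θ θ' R P)))
      = op b • Q (spinorNablaHat nP w ψ) + op (deriv w b) • (ψ : Spinors θ θ' R P)
    -- The derivative term is a multiple of `ψ`, which `Q` fixes, so the Leibniz rule survives the
    -- projection.
    rw [spinorNablaHat_op_smul, map_add, hQb, hQb, hQ.apply_of_mem ψ.2]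
  compatible w ψ φ := by
    change deriv w (spinorInner hR hP ψ φ) = spinorInner hR hP ψ (Q (spinorNablaHat nP w φ))
      - spinorInner hR hP (Q (spinorNablaHat nP w ψ)) φ
    -- `Q` is moved to the other argument, where it acts as the identity; compatibility is then that
    -- of the unprojected `∇̂`.
    rw [← hQ.hermitian, hQ.hermitian _ (φ : Spinors θ θ' R P), hQ.apply_of_mem ψ.2,
      hQ.apply_of_mem φ.2, deriv_spinorInner]

theorem coe_opCommutator_projectedConnection (hRproj : hR.IsProjective)
    {N : Submodule (SmoothTorus θ')ᵐᵒᵖ (Spinors θ θ' R P)}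
    {Q : Spinors θ θ' R P →ₗ[ℂ] Spinors θ θ' R P} (hQ : IsOrthogonalProjection hR hP N Q)
    (hQb : ∀ (b : (SmoothTorus θ')ᵐᵒᵖ) ψ, Q (b • ψ) = b • Q ψ) (v w : LieAlg) (ψ : N) :
    (opCommutator ((projectedConnection nP hRproj hQ hQb).nabla v)
        ((projectedConnection nP hRproj hQ hQb).nabla w) ψ : Spinors θ θ' R P)
      = Q (spinorNablaHat nP v (Q (spinorNablaHat nP w ψ)))
        - Q (spinorNablaHat nP w (Q (spinorNablaHat nP v ψ))) := rfl

theorem coe_selfDualPart {N : Submodule (SmoothTorus θ')ᵐᵒᵖ (Spinors θ θ' R P)}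
    (F : Fin 4 → Fin 4 → N) (i j : Fin 4) : ((selfDualPart F i j : N) : Spinors θ θ' R P)
      = selfDualPart (fun k l => (F k l : Spinors θ θ' R P)) i j :=
  map_selfDualPart (N.subtype.restrictScalars ℂ) F i j

end transform

end operators
end
end NCNahm

/-! ### The Nahm transform of an instanton -/

theorem theorem2p5
    -- the tori `A_θ`, `A_θ'` and the module `P` over `A_{θ ⊕ (-θ')}`
    (θ θ' : SkewForm (Fin 4))
    {P : Type*} [AddCommGroup P] [Module ℂ P] [Module (SmoothTorus (θ.diff θ')) P]
    [IsScalarTower ℂ (SmoothTorus (θ.diff θ')) P]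
    (hP : LeftHermitianForm (θ.diff θ') P) (hPproj : hP.IsProjective)
    -- its connection `∇ ⊕ ∇̂`, of constant curvature `Ω = (ω, σ; -σᵀ, ω̂)`, with `σ` non-degenerate
    (nP : LeftConnection hP) (Ω : Matrix (Fin 4 ⊕ Fin 4) (Fin 4 ⊕ Fin 4) ℂ)
    (hΩ : HasConstantCurvature nP Ω) (hσ : Ω.toBlocks₁₂.det ≠ 0)
    -- an inner product on `L_θ`, and an orthonormal frame, which also orients `L_θ`
    (g : Matrix (Fin 4) (Fin 4) ℝ) (hg : g.PosDef)
    (α : Fin 4 → LieAlg) (hα : IsOrthonormalFrame g α)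
    -- the module `R` over `A_θ` and its connection
    {R : Type*} [AddCommGroup R] [Module ℂ R] [Module (SmoothTorus θ)ᵐᵒᵖ R]
    [IsScalarTower ℂ (SmoothTorus θ)ᵐᵒᵖ R]
    (hR : HermitianForm θ R) (hRproj : hR.IsProjective) (nR : Connection hR)
    (hirr : IsPIrreducible nR nP α)
    -- `F⁺ + ω⁺ · 1 = 0`
    (hF : ∀ i j,
      selfDualPart (fun k l => opCommutator (nR.nabla (α k)) (nR.nabla (α l))) i j
        + selfDualPart (fun k l => twoForm Ω.toBlocks₁₁ (α k) (α l)) i j • LinearMap.id = 0) :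
    -- there is a unique orthogonal projection `Q` onto `R̂ = ker D⁻`,
    ∃ Q : Spinors θ θ' R P →ₗ[ℂ] Spinors θ θ' R P,
      IsOrthogonalProjection hR hP (nahmModule nR nP α) Q ∧
      (∀ Q', IsOrthogonalProjection hR hP (nahmModule nR nP α) Q' → Q' = Q) ∧
      -- `R̂` is a Hermitian `A_θ'`-module and `Q ∘ ∇̂'` is a Hermitian connection on it,
      ∃ (hN : HermitianForm θ' (nahmModule nR nP α)) (nN : Connection hN),
        (∀ ψ φ, hN.inner ψ φ = spinorInner hR hP (ψ : Spinors θ θ' R P) φ) ∧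
        (∀ w ψ, (nN.nabla w ψ : Spinors θ θ' R P) = Q (spinorNablaHat nP w ψ)) ∧
        -- with `F̂⁺ - ω̂⁺ · 1 = 0`
        ∀ β : Fin 4 → LieAlg, IsOrthonormalFrame (dualInner g Ω.toBlocks₁₂) β →
          IsPositivelyOriented Ω.toBlocks₁₂ α β → ∀ i j,
            selfDualPart (fun k l => opCommutator (nN.nabla (β k)) (nN.nabla (β l))) i j
              - selfDualPart (fun k l => twoForm Ω.toBlocks₂₂ (β k) (β l)) i j • LinearMap.id
              = 0 := by
  obtain ⟨G, hGL', hLG', -⟩ := hirr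
  have hGL : ∀ x, G (laplacian nR nP α x) = x := LinearMap.congr_fun hGL'
  have hLG : ∀ x, laplacian nR nP α (G x) = x := LinearMap.congr_fun hLG'
  have hD := dirac_gammaMinus_gammaPlus nR (selfDualPart_opCommutator_tensorNabla nR hΩ hF)
  have hQ := isOrthogonalProjection_nahmProjection hLG hD
  refine ⟨nahmProjection nR nP α G, hQ, fun Q' hQ' => hQ.unique hRproj hQ',
    spinorHermitianForm hR hP hRproj _,
    projectedConnection nP hRproj hQ (nahmProjection_op_smul hGL hLG),
    fun _ _ => rfl, fun _ _ => rfl, fun β hβ hαβ i j => ?_⟩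
  -- The operator identity on `ker D⁻` is tested on vectors and compared inside the ambient spinors,
  -- where the curvature was computed.
  refine selfDualPart_sub_smul_id_eq_zero _ _ fun ψ => Subtype.ext ?_
  rw [coe_selfDualPart]
  simp only [coe_opCommutator_projectedConnection]
  rw [selfDualPart_nahm_curvature hRproj hGL hD hΩ hα hβ hαβ ψ.2 i j]
  rfl
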